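/- **Setting.** Let $N,K,L$ be positive integers with $L\le N$, and let $q$ be a prime. A server holds $N$ independent files $W_0,\dots,W_{N-1}$, each uniformly distributed over $\mathbb F_q^F$, and is connected to $K$ users by an error-free shared link. User $k$ requests a vector $\mathbf d_k=(d_{k,0},\dots,d_{k,L-1})$ of $L$ distinct file indices, and $\mathbf D=(\mathbf d_0,\dots,\mathbf d_{K-1})$; the $\mathbf d_k$ are independent of each other, and every vector of $L$ distinct indices has positive probability. A scheme with file size $F$ consists of random variables $S_k$ (shared by the server and user $k$) and $P$ (known to the server only) over finite alphabets, such that $\mathbf D, W_0,\dots,W_{N-1},P,S_0,\dots,S_{K-1}$ are mutually independent; of cache contents $Z_k=(\phi_k(S_k,P,\mathbf W),S_k)$; and of a broadcast message $X_{\mathbf D}=(\psi(\mathbf D,P,S,\mathbf W),\mu(\mathbf D,P,S))$. Here $\phi_k$ and $\psi$ take values in vectors over $\mathbb F_q$, and $\mu$ in a finite set $\mathcal J$. With entropies in base $q$, the scheme is correct if $H(W_{d_{k,0}},\dots,W_{d_{k,L-1}}\mid X_{\mathbf D},\mathbf d_k,Z_k)=0$ for all $k$, and demand-private if $I(\mathbf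 D_{\setminus k};X_{\mathbf D},Z_k,\mathbf d_k)=0$ for all $k$, where $\mathbf D_{\setminus k}$ denotes the demands of the users other than $k$. A pair $(M,R)$ is achievable if for every $\varepsilon>0$ and all sufficiently large $F$ there is a correct and demand-private scheme in which every $\phi_k$ has at most $(M+\varepsilon)F$ symbols, $\psi$ has at most $(R+\varepsilon)F$ symbols (so that $H(\phi_k(S_k,P,\mathbf W))\le (M+\varepsilon)F$, and $H(\psi(\mathbf D,P,S,\mathbf W))\le (R+\varepsilon)F$ for every fixed $\mathbf D$), and the alphabets of the $S_k$ and $\mathcal J$ have at most $q^{\varepsilon F}$ elements. Let $R^{*\mathrm p}_{N,K,L}(M)=\inf\{R:(M,R)\text{ is achievable}\}$. Let $\bar N=\min\{N,KL\}$, and let $R^{\mathrm p}_{N,K,L}$ be the lower convex envelope of the pairs $$(M,R)=\left(\frac{\binom{K\bar N}{r}-\binom{K\bar N-L}{r}}{\binom{K\bar N}{r}}\,N,\ \frac{\binom{K\bar N}{r+1}-\binom{(K-1)\bar N}{r+1}}{\binom{K\bar N}{r}}\right),\qquad r=0,1,\dots,K\bar N .$$ **Theorem.** For every $M\in[0,N]$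 the pair $(M,R^{\mathrm p}_{N,K,L}(M))$ is achievable, and $R^{\mathrm p}_{N,K,L}(M)$ is within a factor of $6$ of the optimal demand-private tradeoff: $$R^{*\mathrm p}_{N,K,L}(M)\ \le\ R^{\mathrm p}_{N,K,L}(M)\ \le\ 6\,R^{*\mathrm p}_{N,K,L}(M).$$ -/

import Mathlib

open scoped BigOperators

noncomputable section

namespace CodedCaching

/-! ### Shannon entropy of finite random variables, in base `q` -/

section Entropy

variable {Ω α β : Type} [Fintype Ω] [Fintype α] [Fintype β]

open Classical in
/-- `Pr (X = x)` when the sample space `Ω` carries the probability weights `w`. -/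
def prob (w : Ω → ℝ) (X : Ω → α) (x : α) : ℝ :=
  ∑ ω, if X ω = x then w ω else 0

/-- The entropy `H(X) = - ∑ x, Pr(X = x) log_q Pr(X = x)`. -/
def entropy (q : ℕ) (w : Ω → ℝ) (X : Ω → α) : ℝ :=
  ∑ x, Real.negMulLog (prob w X x) / Real.log q

/-- The conditional entropy `H(X | Y) = H(X, Y) - H(Y)`. -/
def condEntropy (q : ℕ) (w : Ω → ℝ) (X : Ω → α) (Y : Ω → β) : ℝ :=
  entropy q w (fun ω => (X ω, Y ω)) - entropy q w Y

/-- The mutual information `I(X; Y) = H(X) + H(Y) - H(X, Y)`. -/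
def mutualInfo (q : ℕ) (w : Ω → ℝ) (X : Ω → α) (Y : Ω → β) : ℝ :=
  entropy q w X + entropy q w Y - entropy q w (fun ω => (X ω, Y ω))

end Entropy

/-! ### The system model -/

/-- A library of `N` files, each a vector of `F` symbols of the field with `q` elements. -/
abbrev Library (q N F : ℕ) : Type := Fin N → Fin F → ZMod q

/-- The demand vector of one user: `L` distinct files out of `N`. -/
abbrev Demand (N L : ℕ) : Type := Fin L ↪ Fin N

/-- A demand matrix: one demand vector for each of the `K` users. -/
abbrev DemandMatrix (N K L : ℕ) : Type := Fin K → Demand N L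

/-- The alphabets, the laws of the auxiliary random variables, and the caching and encoding
functions of a coded caching scheme with file size `F`. -/
structure Scheme (q N K L F : ℕ) where
  /-- the alphabet of the random variable `S k` that the server provides to user `k` -/
  Key : Fin K → Type
  [keyFintype : ∀ k, Fintype (Key k)]
  /-- the law of `S k` -/
  keyLaw : ∀ k, Key k → ℝ
  keyLaw_mem : ∀ k, keyLaw k ∈ stdSimplex ℝ (Key k)
  /-- the alphabet of the random variable `P` that only the server knows -/
  Server : Type
  [serverFintype : Fintype Server]
  /-- the law of `P` -/
  serverLaw : Server → ℝ
  serverLaw_mem : serverLaw ∈ stdSimplex ℝ Server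
  /-- the alphabet of the part of the broadcast message that does not depend on the files -/
  Header : Type
  [headerFintype : Fintype Header]
  /-- the number of symbols in each cache, apart from `S k` -/
  cacheLen : ℕ
  /-- the number of symbols in the broadcast message, apart from the header -/
  msgLen : ℕ
  /-- the caching functions -/
  cache : ∀ k, Key k → Server → Library q N F → (Fin cacheLen → ZMod q)
  /-- the encoding function for the file-dependent part of the message -/
  encode : DemandMatrix N K L → Server → (∀ k, Key k) → Library q N F → (Fin msgLen → ZMod q)
  /-- the encoding function for the header -/
  header : DemandMatrix N K L → Server → (∀ k, Key k) → Header

attribute [instance] Scheme.keyFintype Scheme.serverFintype Scheme.headerFintype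

namespace Scheme

variable {q N K L F : ℕ} [NeZero q] (𝒮 : Scheme q N K L F)

/-- The values of the files and of the auxiliary random variables, `(W, P, S)`. -/
abbrev Source : Type := Library q N F × 𝒮.Server × (∀ k, 𝒮.Key k)

/-- The law of `(W, P, S)`: all components are independent, and `W` is uniform. -/
def sourceLaw (ω : 𝒮.Source) : ℝ :=
  (Fintype.card (Library q N F) : ℝ)⁻¹ * 𝒮.serverLaw ω.2.1 * ∏ k, 𝒮.keyLaw k (ω.2.2 k)

/-- The law of `(D, W, P, S)` when the demands of the users are independent of each other and
of everything else, and user `k` has the demand vector `d` with probability `δ k d`. -/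
def jointLaw (δ : Fin K → Demand N L → ℝ) (ω : DemandMatrix N K L × 𝒮.Source) : ℝ :=
  (∏ k, δ k (ω.1 k)) * 𝒮.sourceLaw ω.2

/-- The cached symbols of user `k`, as a random variable. -/
def cacheSymbols (k : Fin K) (ω : 𝒮.Source) : Fin 𝒮.cacheLen → ZMod q :=
  𝒮.cache k (ω.2.2 k) ω.2.1 ω.1

/-- The file-dependent part of the message for the demand matrix `D`, as a random variable. -/
def msgSymbols (D : DemandMatrix N K L) (ω : 𝒮.Source) : Fin 𝒮.msgLen → ZMod q :=
  𝒮.encode D ω.2.1 ω.2.2 ω.1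

/-- The cache content of user `k`: the cached symbols together with `S k`. -/
def Z (k : Fin K) (ω : DemandMatrix N K L × 𝒮.Source) :
    (Fin 𝒮.cacheLen → ZMod q) × 𝒮.Key k :=
  (𝒮.cacheSymbols k ω.2, ω.2.2.2 k)

/-- The broadcast message: the encoded symbols together with the header. -/
def X (ω : DemandMatrix N K L × 𝒮.Source) : (Fin 𝒮.msgLen → ZMod q) × 𝒮.Header :=
  (𝒮.msgSymbols ω.1 ω.2, 𝒮.header ω.1 ω.2.2.1 ω.2.2.2)

/-- Correctness: `H(W_{d_{k,0}}, …, W_{d_{k,L-1}} | X, d_k, Z_k) = 0` for every user `k`. -/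
def Correct (δ : Fin K → Demand N L → ℝ) : Prop :=
  ∀ k : Fin K,
    condEntropy q (𝒮.jointLaw δ)
      (fun ω => fun l : Fin L => ω.2.1 (ω.1 k l))
      (fun ω => (𝒮.X ω, ω.1 k, 𝒮.Z k ω)) = 0

/-- Demand privacy: `I(D_{∖k}; X, Z_k, d_k) = 0` for every user `k`. -/
def DemandPrivate (δ : Fin K → Demand N L → ℝ) : Prop :=
  ∀ k : Fin K,
    mutualInfo q (𝒮.jointLaw δ)
      (fun ω => fun j : {j : Fin K // j ≠ k} => ω.1 j)
      (fun ω => (𝒮.X ω, 𝒮.Z k ω, ω.1 k)) = 0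

/-- The cache size is at most `m` file sizes: `m F` symbols, hence also entropy `m F`. -/
def CacheSizeLE (m : ℝ) : Prop :=
  (𝒮.cacheLen : ℝ) ≤ m * F ∧
    ∀ k, entropy q 𝒮.sourceLaw (𝒮.cacheSymbols k) ≤ m * F

/-- The rate is at most `r`: for every demand matrix the message has at most `r F` symbols,
hence also entropy at most `r F`. -/
def RateLE (r : ℝ) : Prop :=
  (𝒮.msgLen : ℝ) ≤ r * F ∧
    ∀ D, entropy q 𝒮.sourceLaw (𝒮.msgSymbols D) ≤ r * F

/-- The alphabets of the `S k` and of the header take at most `ε F` symbols to describe. -/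
def OverheadLE (ε : ℝ) : Prop :=
  (∀ k, Real.logb q (Fintype.card (𝒮.Key k)) ≤ ε * F) ∧
    Real.logb q (Fintype.card 𝒮.Header) ≤ ε * F

end Scheme

/-- The pair `(M, R)` is achievable: for all sufficiently large file sizes there are correct and
demand-private schemes with cache size `M` and rate `R`, up to an arbitrarily small slack, whose
keys and headers have negligible size. -/
def Achievable (q N K L : ℕ) [NeZero q] (δ : Fin K → Demand N L → ℝ) (M R : ℝ) : Prop :=
  ∀ ε : ℝ, 0 < ε → ∃ F₀ : ℕ, ∀ F : ℕ, F₀ ≤ F →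
    ∃ 𝒮 : Scheme q N K L F,
      𝒮.CacheSizeLE (M + ε) ∧ 𝒮.RateLE (R + ε) ∧ 𝒮.OverheadLE ε ∧
        𝒮.Correct δ ∧ 𝒮.DemandPrivate δ

/-- The optimal memory-rate tradeoff: the infimum of the `R` with `(M, R)` achievable. -/
def optimalRate (q N K L : ℕ) [NeZero q] (δ : Fin K → Demand N L → ℝ) (M : ℝ) : ℝ :=
  sInf {R : ℝ | Achievable q N K L δ M R}

/-! ### The tradeoff of the proposed scheme -/

/-- `N̄ = min {N, K L}`. -/
def Nbar (N K L : ℕ) : ℕ := min N (K * L)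

/-- The memory-rate pair of the proposed scheme with parameter `r`. -/
def schemePoint (N K L r : ℕ) : ℝ × ℝ :=
  (((((K * Nbar N K L).choose r : ℝ) - ((K * Nbar N K L - L).choose r : ℝ))
      / ((K * Nbar N K L).choose r : ℝ)) * N,
    (((K * Nbar N K L).choose (r + 1) : ℝ) - (((K - 1) * Nbar N K L).choose (r + 1) : ℝ))
      / ((K * Nbar N K L).choose r : ℝ))

/-- The lower convex envelope at `M` of the pairs `schemePoint N K L r`, `0 ≤ r ≤ K N̄`: the least
`R` such that `(M, R)` is a convex combination of these pairs. -/
def schemeRate (N K L : ℕ) (M : ℝ) : ℝ :=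
  sInf {R : ℝ | (M, R) ∈
    convexHull ℝ (schemePoint N K L '' Set.Icc 0 (K * Nbar N K L))}

end CodedCaching

end

/-!
The pair `(M, R^p(M))` is achievable by a virtual-user scheme, and the factor `6` comes from an
averaged cut-set bound.

Achievability. Give every user a stack of `N̄` virtual users, `L` of which it really controls; the
secret positions of these are given by a uniform permutation, the key of the user. The demand
vectors of all users lie in a common set of `N̄` files, and every stack demands exactly this set.
Moreover a secret uniform permutation `σ` relabels the files before anything is cached. Relative
to the relabelled library the demands of the virtual users can be sent in the clear: as seen by
user `k`, who knows its key but not `σ`, they are a uniformly random `N̄`-set of labels, put on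
every stack in uniformly random order, whatever the demands are. Formally, for any two demand
matrices a law-preserving permutation of the sources carries the message and the cache of user `k`
for one of them to those for the other (`virtualScheme_demandPrivate`).

The content of the message is the usual multicast for `K N̄` virtual users: for every set `T` of
virtual users, the signed sum over `v ∈ T` of the piece of the file demanded by `v` that is cached
by `T ∖ {v}`. These sums are the coordinates of `∑ v, v ∧ w (g v)` in an exterior algebra, and
those for the sets `T` that contain no member of the first stack are redundant
(`codedSum_eq_zero`). This leaves `(K N̄).choose (r + 1) - ((K - 1) N̄).choose (r + 1)` symbols.
Cutting the files into pieces for all `r` at once realizes all convex combinations with a single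
key and header (`achievable_of_mem_convexHull`).

Converse. The caches of `i ≤ K` users and one message determine `i L` files. Averaging over the
cyclic shifts of a window of `i L ≤ N` files by Shearer's inequality gives
`R ≥ i L (1 - i M / N)` (`Achievable.cutSet`). On the other side, the envelope lies below the
hyperbola `R = L N / M` (`exists_mem_schemeRegion_le`) and below the chord from `(0, N̄)` to
`(N, 0)`. Choosing `i` near `N / (2 M)`, or as large as possible if this is too large, compares the
two (`schemeRate_le_six_mul`).
-/

noncomputable section

namespace CodedCaching

/-! ### Entropy and functional dependence -/

section EntropyFacts

variable {Ω α β : Type} [Fintype Ω]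

lemma prob_nonneg {w : Ω → ℝ} (hw : ∀ ω, 0 ≤ w ω) (X : Ω → α) (x : α) : 0 ≤ prob w X x :=
  Finset.sum_nonneg fun ω _ => by split_ifs <;> simp [hw]

lemma sum_prob [Fintype α] (w : Ω → ℝ) (X : Ω → α) : ∑ x, prob w X x = ∑ ω, w ω := by
  classical
  unfold prob
  rw [Finset.sum_comm]
  exact Finset.sum_congr rfl fun ω _ => by simp

lemma sum_prob_pair_right [Fintype β] (w : Ω → ℝ) (X : Ω → α) (Y : Ω → β) (x : α) :
    ∑ y, prob w (fun ω => (X ω, Y ω)) (x, y) = prob w X x := by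
  classical
  unfold prob
  rw [Finset.sum_comm]
  refine Finset.sum_congr rfl fun ω _ => ?_
  by_cases h : X ω = x <;> simp [h]

lemma sum_prob_pair_left [Fintype α] (w : Ω → ℝ) (X : Ω → α) (Y : Ω → β) (y : β) :
    ∑ x, prob w (fun ω => (X ω, Y ω)) (x, y) = prob w Y y := by
  classical
  unfold prob
  rw [Finset.sum_comm]
  refine Finset.sum_congr rfl fun ω _ => ?_
  by_cases h : Y ω = y <;> simp [h]

lemma le_prob {w : Ω → ℝ} (hw : ∀ ω, 0 ≤ w ω) (X : Ω → α) (ω : Ω) : w ω ≤ prob w X (X ω) := by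
  classical
  have h := Finset.single_le_sum
    (f := fun ω' => if X ω' = X ω then w ω' else 0)
    (fun ω' _ => by split_ifs <;> simp [hw]) (Finset.mem_univ ω)
  unfold prob
  simpa using h

variable [Fintype α] [Fintype β]

/-- The uniform distribution maximizes the entropy. -/
lemma entropy_le_logb_card {q : ℕ} (hq : 1 < q) {w : Ω → ℝ} (hw : w ∈ stdSimplex ℝ Ω)
    (X : Ω → α) : entropy q w X ≤ Real.logb q (Fintype.card α) := by
  have hlog : 0 < Real.log q := Real.log_pos (by exact_mod_cast hq)
  have hsum : ∑ x, prob w X x = 1 := by rw [sum_prob, hw.2]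
  have hne : Nonempty α := by
    by_contra h
    rw [not_nonempty_iff] at h
    simp at hsum
  have hc : (0 : ℝ) < Fintype.card α := by exact_mod_cast Fintype.card_pos
  have hJ := Real.concaveOn_negMulLog.le_map_sum (t := Finset.univ)
    (w := fun _ : α => (Fintype.card α : ℝ)⁻¹) (p := fun x => prob w X x)
    (fun _ _ => by positivity) (by simp [hc.ne'])
    (fun x _ => prob_nonneg hw.1 X x)
  simp only [smul_eq_mul, ← Finset.mul_sum, hsum, mul_one] at hJ
  unfold entropy Real.logb
  rw [← Finset.sum_div]
  refine div_le_div_of_nonneg_right ?_ hlog.le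
  rw [Real.negMulLog, Real.log_inv, neg_mul_neg] at hJ
  exact le_of_mul_le_mul_left hJ (by positivity)

lemma entropy_vector_le {q : ℕ} [NeZero q] (hq : 1 < q) {w : Ω → ℝ} (hw : w ∈ stdSimplex ℝ Ω)
    {n : ℕ} (X : Ω → Fin n → ZMod q) : entropy q w X ≤ n := by
  refine (entropy_le_logb_card hq hw X).trans_eq ?_
  have hq' : (1 : ℝ) < q := by exact_mod_cast hq
  rw [Fintype.card_fun, ZMod.card, Fintype.card_fin, Nat.cast_pow, Real.logb_pow,
    Real.logb_self_eq_one hq', mul_one]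

/-- A random variable that is a function of the observation has no remaining uncertainty. -/
lemma condEntropy_eq_zero_of_factors (q : ℕ) (w : Ω → ℝ) (X : Ω → α) (Y : Ω → β)
    (h : ∀ ω ω', Y ω = Y ω' → X ω = X ω') : condEntropy q w X Y = 0 := by
  classical
  have key : ∀ y : β, ∑ x, Real.negMulLog (prob w (fun ω => (X ω, Y ω)) (x, y)) / Real.log q
      = Real.negMulLog (prob w Y y) / Real.log q := by
    intro y
    by_cases hy : ∃ ω, Y ω = y
    · obtain ⟨ω₀, rfl⟩ := hy
      rw [Finset.sum_eq_single (X ω₀)]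
      · congr 2
        unfold prob
        refine Finset.sum_congr rfl fun ω _ => ?_
        by_cases hω : Y ω = Y ω₀
        · simp [hω, h _ _ hω]
        · simp [hω]
      · intro x _ hx
        have : prob w (fun ω => (X ω, Y ω)) (x, Y ω₀) = 0 := by
          unfold prob
          refine Finset.sum_eq_zero fun ω _ => ?_
          rw [if_neg]
          rintro hω
          rw [Prod.mk.injEq] at hω
          exact hx (by rw [← hω.1, h _ _ hω.2])
        simp [this]
      · simp
    · push Not at hy
      have h1 : ∀ x, prob w (fun ω => (X ω, Y ω)) (x, y) = 0 := fun x => by simp [prob, hy]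
      have h2 : prob w Y y = 0 := by simp [prob, hy]
      simp [h1, h2]
  unfold condEntropy entropy
  rw [Fintype.sum_prod_type_right, Finset.sum_congr rfl fun y _ => key y, sub_self]

/-- If `H(X | Y) = 0`, then on the support of the law `X` is a function of `Y`. -/
lemma factors_of_condEntropy_eq_zero {q : ℕ} (hq : 1 < q) {w : Ω → ℝ} (hw : ∀ ω, 0 ≤ w ω)
    (X : Ω → α) (Y : Ω → β) (h : condEntropy q w X Y = 0) {ω ω' : Ω} (hω : 0 < w ω)
    (hω' : 0 < w ω') (hY : Y ω = Y ω') : X ω = X ω' := by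
  classical
  have hlog : 0 < Real.log q := Real.log_pos (by exact_mod_cast hq)
  set p : α → β → ℝ := fun x y => prob w (fun ω => (X ω, Y ω)) (x, y) with hp
  have hp0 : ∀ x y, 0 ≤ p x y := fun x y => prob_nonneg hw _ _
  have hpY : ∀ y, ∑ x, p x y = prob w Y y := fun y => sum_prob_pair_left w X Y y
  have hple : ∀ x y, p x y ≤ prob w Y y := fun x y => by
    rw [← hpY]
    exact Finset.single_le_sum (fun x _ => hp0 x y) (Finset.mem_univ x)
  -- the conditional entropy is a sum of nonnegative terms `p(x, y) log (p(y) / p(x, y))`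
  have hterm : ∀ x y, 0 ≤ p x y * (Real.log (prob w Y y) - Real.log (p x y)) := fun x y => by
    rcases (hp0 x y).eq_or_lt with h0 | h0
    · simp [← h0]
    · exact mul_nonneg h0.le (sub_nonneg.2 (Real.log_le_log h0 (hple x y)))
  have hsum : ∑ y, ∑ x, p x y * (Real.log (prob w Y y) - Real.log (p x y)) = 0 := by
    have h1 : ∑ y, ∑ x, p x y * (Real.log (prob w Y y) - Real.log (p x y))
        = ∑ y, (∑ x, Real.negMulLog (p x y) - Real.negMulLog (prob w Y y)) := by
      refine Finset.sum_congr rfl fun y _ => ?_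
      simp only [mul_sub, Finset.sum_sub_distrib, ← Finset.sum_mul, hpY, Real.negMulLog,
        Finset.sum_neg_distrib, neg_mul]
      ring
    unfold condEntropy entropy at h
    rw [Fintype.sum_prod_type_right] at h
    simp only [← Finset.sum_div] at h
    rw [← sub_div, div_eq_zero_iff, or_iff_left hlog.ne'] at h
    rw [h1, Finset.sum_sub_distrib]
    exact h
  have hzero : ∀ x y, p x y * (Real.log (prob w Y y) - Real.log (p x y)) = 0 := fun x y => by
    have h2 := (Finset.sum_eq_zero_iff_of_nonneg
      (fun y _ => Finset.sum_nonneg fun x _ => hterm x y)).1 hsum y (Finset.mem_univ y)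
    exact (Finset.sum_eq_zero_iff_of_nonneg (fun x _ => hterm x y)).1 h2 x (Finset.mem_univ x)
  have hfull : ∀ x y, 0 < p x y → p x y = prob w Y y := fun x y hxy => by
    have h3 := (mul_eq_zero.1 (hzero x y)).resolve_left hxy.ne'
    exact (Real.log_injOn_pos (Set.mem_Ioi.2 (hxy.trans_le (hple x y))) (Set.mem_Ioi.2 hxy)
      (sub_eq_zero.1 h3)).symm
  by_contra hne
  have ha : 0 < p (X ω) (Y ω) := hω.trans_le (le_prob hw (fun ω => (X ω, Y ω)) ω)
  have hb : 0 < p (X ω') (Y ω) := by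
    have := hω'.trans_le (le_prob hw (fun ω => (X ω, Y ω)) ω')
    simpa only [hp, hY] using this
  have hadd : p (X ω) (Y ω) + p (X ω') (Y ω) ≤ prob w Y (Y ω) := by
    rw [← hpY, ← Finset.sum_pair (f := fun x => p x (Y ω)) hne]
    exact Finset.sum_le_sum_of_subset_of_nonneg (Finset.subset_univ _) fun x _ _ => hp0 x _
  rw [hfull _ _ ha, hfull _ _ hb] at hadd
  have := hfull _ _ ha
  linarith

/-- Independent random variables have mutual information zero. It suffices that the joint law
factors in any way. -/
lemma mutualInfo_eq_zero_of_factors (q : ℕ) {w : Ω → ℝ} (hw : w ∈ stdSimplex ℝ Ω)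
    (X : Ω → α) (Y : Ω → β) (f : α → ℝ) (g : β → ℝ)
    (h : ∀ x y, prob w (fun ω => (X ω, Y ω)) (x, y) = f x * g y) : mutualInfo q w X Y = 0 := by
  have hX : ∀ x, prob w X x = f x * ∑ y, g y := fun x => by
    rw [← sum_prob_pair_right w X Y, Finset.mul_sum]
    exact Finset.sum_congr rfl fun y _ => h x y
  have hY : ∀ y, prob w Y y = (∑ x, f x) * g y := fun y => by
    rw [← sum_prob_pair_left w X Y, Finset.sum_mul]
    exact Finset.sum_congr rfl fun x _ => h x y
  have hone : (∑ x, f x) * ∑ y, g y = 1 := by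
    rw [Finset.sum_mul, ← Finset.sum_congr rfl fun x _ => hX x, sum_prob, hw.2]
  have hXY : ∀ x y, prob w (fun ω => (X ω, Y ω)) (x, y) = prob w X x * prob w Y y := by
    intro x y
    rw [h, hX, hY]
    linear_combination (- f x * g y) * hone
  unfold mutualInfo entropy
  rw [Fintype.sum_prod_type]
  simp only [hXY, Real.negMulLog_mul, add_div, Finset.sum_add_distrib]
  have hx1 : ∑ x, prob w X x = 1 := by rw [sum_prob, hw.2]
  have hy1 : ∑ y, prob w Y y = 1 := by rw [sum_prob, hw.2]
  have e1 : ∑ x, ∑ y, prob w Y y * Real.negMulLog (prob w X x) / Real.log q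
      = ∑ x, Real.negMulLog (prob w X x) / Real.log q :=
    Finset.sum_congr rfl fun x _ => by
      simp only [mul_div_assoc]
      rw [← Finset.sum_mul, hy1, one_mul]
  have e2 : ∑ x, ∑ y, prob w X x * Real.negMulLog (prob w Y y) / Real.log q
      = ∑ y, Real.negMulLog (prob w Y y) / Real.log q := by
    simp only [mul_div_assoc]
    rw [← Finset.sum_mul_sum, hx1, one_mul]
  rw [e1, e2]
  ring

end EntropyFacts

/-! ### Signed sums: left multiplication in an exterior algebra -/

section SignedSums

variable {V R : Type} [LinearOrder V] [CommRing R]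

/-- The sign of `v` in `T`: `(-1)` to the number of elements of `T` below `v`. -/
def vsign (R : Type) [CommRing R] (v : V) (T : Finset V) : R := (-1) ^ (T.filter (· < v)).card

/-- Left multiplication by the basis vector `v` on the exterior algebra of `R^V`, whose elements
are written as functions on the finite subsets of `V`. -/
def wedge (v : V) (y : Finset V → R) (T : Finset V) : R :=
  if v ∈ T then vsign R v T * y (T.erase v) else 0

/-- Left multiplication by the sum of the basis vectors in `A`. -/
def wedgeSum (A : Finset V) (y : Finset V → R) (T : Finset V) : R := ∑ v ∈ A, wedge v y T

lemma vsign_mul_self (v : V) (T : Finset V) : vsign R v T * vsign R v T = 1 := by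
  rw [vsign, ← mul_pow, neg_one_mul, neg_neg, one_pow]

lemma vsign_erase_of_le {u v : V} (h : v ≤ u) (T : Finset V) :
    vsign R v (T.erase u) = vsign R v T := by
  unfold vsign
  rw [Finset.filter_erase, Finset.erase_eq_of_notMem]
  simp [h]

lemma vsign_erase_of_lt {u v : V} (h : u < v) {T : Finset V} (hu : u ∈ T) :
    vsign R v (T.erase u) = - vsign R v T := by
  unfold vsign
  have hm : u ∈ T.filter (· < v) := Finset.mem_filter.2 ⟨hu, h⟩
  rw [Finset.filter_erase, ← Finset.card_erase_add_one hm, pow_succ]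
  ring

lemma wedge_wedge_self (v : V) (y : Finset V → R) (T : Finset V) : wedge v (wedge v y) T = 0 := by
  simp [wedge]

lemma wedge_wedge_comm (u v : V) (y : Finset V → R) (T : Finset V) :
    wedge u (wedge v y) T = - wedge v (wedge u y) T := by
  rcases lt_trichotomy u v with h | rfl | h
  · by_cases hu : u ∈ T <;> by_cases hv : v ∈ T <;>
      simp [wedge, hu, hv, h.ne, h.ne', vsign_erase_of_lt, vsign_erase_of_le, h, h.le,
        Finset.erase_right_comm (a := u) (b := v)]
    ring
  · simp [wedge_wedge_self]
  · by_cases hu : u ∈ T <;> by_cases hv : v ∈ T <;>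
      simp [wedge, hu, hv, h.ne, h.ne', vsign_erase_of_lt, vsign_erase_of_le, h, h.le,
        Finset.erase_right_comm (a := u) (b := v)]
    ring

lemma wedge_sum {I : Type} (v : V) (s : Finset I) (f : I → Finset V → R) (T : Finset V) :
    wedge v (fun T => ∑ i ∈ s, f i T) T = ∑ i ∈ s, wedge v (f i) T := by
  unfold wedge
  split_ifs <;> simp [Finset.mul_sum]

lemma wedgeSum_sum {I : Type} (A : Finset V) (s : Finset I) (f : I → Finset V → R)
    (T : Finset V) :
    wedgeSum A (fun T => ∑ i ∈ s, f i T) T = ∑ i ∈ s, wedgeSum A (f i) T := by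
  unfold wedgeSum
  simp only [wedge_sum]
  exact Finset.sum_comm

lemma wedgeSum_neg (A : Finset V) (y : Finset V → R) (T : Finset V) :
    wedgeSum A (fun T => - y T) T = - wedgeSum A y T := by
  simp only [wedgeSum, wedge, mul_neg, ← Finset.sum_neg_distrib]
  exact Finset.sum_congr rfl fun v _ => by split_ifs <;> simp

lemma sum_sum_eq_zero_of_antisymm {I : Type} (A : Finset I) (φ : I → I → R)
    (hd : ∀ i, φ i i = 0) (ha : ∀ i j, φ i j = - φ j i) : ∑ i ∈ A, ∑ j ∈ A, φ i j = 0 := by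
  classical
  induction A using Finset.induction_on with
  | empty => simp
  | insert a A h ih =>
    simp only [Finset.sum_insert h, Finset.sum_add_distrib, ih, hd]
    rw [Finset.sum_congr rfl fun i _ => ha i a, Finset.sum_neg_distrib]
    ring

lemma wedgeSum_wedgeSum_self (A : Finset V) (y : Finset V → R) (T : Finset V) :
    wedgeSum A (wedgeSum A y) T = 0 := by
  have h : wedgeSum A (wedgeSum A y) T = ∑ u ∈ A, ∑ v ∈ A, wedge u (wedge v y) T :=
    Finset.sum_congr rfl fun u _ => wedge_sum u A (fun v => wedge v y) T
  rw [h]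
  exact sum_sum_eq_zero_of_antisymm A (fun u v => wedge u (wedge v y) T)
    (fun u => wedge_wedge_self u y T) (fun u v => wedge_wedge_comm u v y T)

lemma wedgeSum_wedgeSum_comm (A B : Finset V) (y : Finset V → R) (T : Finset V) :
    wedgeSum A (wedgeSum B y) T = - wedgeSum B (wedgeSum A y) T := by
  have h : ∀ A B : Finset V,
      wedgeSum A (wedgeSum B y) T = ∑ u ∈ A, ∑ v ∈ B, wedge u (wedge v y) T := fun A B =>
    Finset.sum_congr rfl fun u _ => wedge_sum u B (fun v => wedge v y) T
  rw [h A B, h B A, Finset.sum_comm, ← Finset.sum_neg_distrib]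
  refine Finset.sum_congr rfl fun v _ => ?_
  rw [← Finset.sum_neg_distrib]
  exact Finset.sum_congr rfl fun u _ => wedge_wedge_comm u v y T

/-- Let `x = ∑ a, f_a ∧ w_a`, where each `f_a` is a sum of basis vectors and `ℓ a` is a basis
vector that occurs in `f_a` only. If the coordinates of `x` at all sets containing some `ℓ a`
vanish, then `x = 0`. The proof eliminates one class at a time: `f_a ∧ x` involves the other
classes only, because `f_a ∧ f_a = 0`. -/
lemma eq_zero_of_wedgeSum {C : Type} (s : Finset C) (A : C → Finset V) (ℓ : C → V)
    (hℓ : ∀ a ∈ s, ∀ b ∈ s, ℓ a ∈ A b ↔ a = b) (w : C → Finset V → R) (x : Finset V → R)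
    (hx : ∀ T, x T = ∑ a ∈ s, wedgeSum (A a) (w a) T)
    (h0 : ∀ T, ∀ a ∈ s, ℓ a ∈ T → x T = 0) (T : Finset V) : x T = 0 := by
  classical
  induction s using Finset.induction_on generalizing w x T with
  | empty => simp [hx]
  | insert a s ha ih =>
    have hstep : ∀ T, wedgeSum (A a) x T = 0 := by
      refine ih (fun b hb c hc => hℓ b (Finset.mem_insert_of_mem hb) c (Finset.mem_insert_of_mem hc))
        (fun b T => - wedgeSum (A a) (w b) T) (wedgeSum (A a) x) (fun T => ?_) ?_
      · rw [show x = fun T => ∑ b ∈ insert a s, wedgeSum (A b) (w b) T from funext hx,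
          wedgeSum_sum, Finset.sum_insert ha, wedgeSum_wedgeSum_self, zero_add]
        refine Finset.sum_congr rfl fun b _ => ?_
        rw [wedgeSum_wedgeSum_comm]
        exact (wedgeSum_neg _ _ _).symm
      · intro T b hb hT
        refine Finset.sum_eq_zero fun v hv => ?_
        unfold wedge
        split_ifs with hvT
        · rw [h0 _ b (Finset.mem_insert_of_mem hb), mul_zero]
          refine Finset.mem_erase.2 ⟨?_, hT⟩
          rintro rfl
          have := (hℓ b (Finset.mem_insert_of_mem hb) a (Finset.mem_insert_self _ _)).1 hv
          exact ha (this ▸ hb)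
        · rfl
    by_cases hT : ℓ a ∈ T
    · exact h0 T a (Finset.mem_insert_self _ _) hT
    have hself : ℓ a ∈ A a :=
      (hℓ a (Finset.mem_insert_self _ _) a (Finset.mem_insert_self _ _)).2 rfl
    have h1 := hstep (insert (ℓ a) T)
    unfold wedgeSum at h1
    rw [Finset.sum_eq_single_of_mem (ℓ a) hself] at h1
    · simp only [wedge, Finset.mem_insert_self, if_true, Finset.erase_insert hT] at h1
      calc x T = vsign R (ℓ a) (insert (ℓ a) T) *
            (vsign R (ℓ a) (insert (ℓ a) T) * x T) := by
              rw [← mul_assoc, vsign_mul_self, one_mul]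
        _ = 0 := by rw [h1, mul_zero]
    · intro v _ hv
      unfold wedge
      split_ifs
      · rw [h0 _ a (Finset.mem_insert_self _ _), mul_zero]
        exact Finset.mem_erase.2 ⟨Ne.symm hv, Finset.mem_insert_self _ _⟩
      · rfl

/-- The coordinate at `T` of `∑ v, v ∧ w (g v)`: the symbol broadcast to the set `T` of virtual
users when `v` demands the file `g v`. -/
def codedSum {C : Type} (g : V → C) (w : C → Finset V → R) (T : Finset V) : R :=
  ∑ v ∈ T, vsign R v T * w (g v) (T.erase v)

lemma codedSum_sub {C : Type} (g : V → C) (w w' : C → Finset V → R) (T : Finset V) :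
    codedSum g (fun c S => w c S - w' c S) T = codedSum g w T - codedSum g w' T := by
  simp [codedSum, mul_sub, Finset.sum_sub_distrib]

/-- The symbols for the sets that contain a leader determine all the others. -/
lemma codedSum_eq_zero [Fintype V] {C : Type} (g : V → C) (w : C → Finset V → R) (Λ : Finset V)
    (hinj : Set.InjOn g Λ) (hsurj : ∀ v, ∃ u ∈ Λ, g u = g v)
    (h0 : ∀ T, (∃ v ∈ Λ, v ∈ T) → codedSum g w T = 0) (T : Finset V) : codedSum g w T = 0 := by
  classical
  refine eq_zero_of_wedgeSum Λ (fun u => Finset.univ.filter fun v => g v = g u) id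
    ?_ (fun u => w (g u)) (codedSum g w) (fun T => ?_) (fun T u hu hT => h0 T ⟨u, hu, hT⟩) T
  · intro a ha b hb
    simpa using hinj.eq_iff ha hb
  · have h1 : codedSum g w T = ∑ v, wedge v (w (g v)) T := by
      simp [codedSum, wedge, Finset.sum_ite_mem]
    rw [h1]
    choose ℓ hℓ hgℓ using hsurj
    rw [← Finset.sum_fiberwise_of_maps_to (s := Finset.univ) (t := Λ) (g := ℓ)
      fun v _ => hℓ v]
    refine Finset.sum_congr rfl fun u hu => ?_
    have h2 : ∀ v, ℓ v = u ↔ g v = g u := fun v =>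
      ⟨fun h => by rw [← h, hgℓ], fun h => hinj (hℓ v) hu (by rw [hgℓ, h])⟩
    unfold wedgeSum
    simp only [h2]
    refine Finset.sum_congr rfl fun v hv => ?_
    rw [(Finset.mem_filter.1 hv).2]

/-- Decoding: a virtual user `v` in `O` recovers the file `g v` from the coded symbols and from
the pieces indexed by the sets that meet `O`. -/
lemma eq_zero_of_codedSum {C : Type} (g : V → C) (w : C → Finset V → R) (O : Finset V)
    (hx : ∀ T, codedSum g w T = 0) (hO : ∀ c S, (∃ v ∈ O, v ∈ S) → w c S = 0)
    {v : V} (hv : v ∈ O) (S : Finset V) : w (g v) S = 0 := by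
  by_cases hS : ∃ u ∈ O, u ∈ S
  · exact hO _ _ hS
  have hvS : v ∉ S := fun h => hS ⟨v, hv, h⟩
  have h1 := hx (insert v S)
  unfold codedSum at h1
  rw [Finset.sum_eq_single_of_mem v (Finset.mem_insert_self _ _), Finset.erase_insert hvS] at h1
  · calc w (g v) S = vsign R v (insert v S) * (vsign R v (insert v S) * w (g v) S) := by
          rw [← mul_assoc, vsign_mul_self, one_mul]
      _ = 0 := by rw [h1, mul_zero]
  · intro u _ hu
    rw [hO _ _ ⟨v, hv, Finset.mem_erase.2 ⟨Ne.symm hu, Finset.mem_insert_self _ _⟩⟩, mul_zero]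

end SignedSums

/-! ### Laws of the sources, and a criterion for demand privacy -/

section Laws

lemma sum_prod_law {K : ℕ} {ι : Fin K → Type} [∀ k, Fintype (ι k)] (p : ∀ k, ι k → ℝ)
    (hp : ∀ k, p k ∈ stdSimplex ℝ (ι k)) : ∑ x : ∀ k, ι k, ∏ k, p k (x k) = 1 := by
  classical
  rw [← Fintype.piFinset_univ, ← Finset.prod_univ_sum]
  exact Finset.prod_eq_one fun k _ => (hp k).2

lemma uniform_mem_stdSimplex (α : Type) [Fintype α] [Nonempty α] :
    (fun _ : α => (Fintype.card α : ℝ)⁻¹) ∈ stdSimplex ℝ α :=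
  ⟨fun _ => by positivity, by simp⟩

namespace Scheme

variable {q N K L F : ℕ} [NeZero q] (𝒮 : Scheme q N K L F)

lemma sourceLaw_mem : 𝒮.sourceLaw ∈ stdSimplex ℝ 𝒮.Source := by
  refine ⟨fun ω => ?_, ?_⟩
  · exact mul_nonneg (mul_nonneg (by positivity) (𝒮.serverLaw_mem.1 _))
      (Finset.prod_nonneg fun k _ => (𝒮.keyLaw_mem k).1 _)
  · unfold sourceLaw
    rw [Fintype.sum_prod_type]
    simp only [Fintype.sum_prod_type, ← Finset.mul_sum, sum_prod_law _ 𝒮.keyLaw_mem, mul_one,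
      𝒮.serverLaw_mem.2]
    simp

lemma jointLaw_mem {δ : Fin K → Demand N L → ℝ} (hδ : ∀ k, δ k ∈ stdSimplex ℝ (Demand N L)) :
    𝒮.jointLaw δ ∈ stdSimplex ℝ (DemandMatrix N K L × 𝒮.Source) := by
  refine ⟨fun ω => mul_nonneg (Finset.prod_nonneg fun k _ => (hδ k).1 _) (𝒮.sourceLaw_mem.1 _), ?_⟩
  unfold jointLaw
  rw [Fintype.sum_prod_type]
  simp only [← Finset.mul_sum, 𝒮.sourceLaw_mem.2, mul_one]
  exact sum_prod_law _ hδ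

/-- A scheme is demand-private if the joint law of the message and of the cache of user `k` is
the same for every demand matrix. This is expressed by a law-preserving permutation of the sources
that makes up for a change of the demand matrix. -/
lemma demandPrivate_of_perm {δ : Fin K → Demand N L → ℝ}
    (hδ : ∀ k, δ k ∈ stdSimplex ℝ (Demand N L))
    (h : ∀ (k : Fin K) (D D' : DemandMatrix N K L), ∃ π : Equiv.Perm 𝒮.Source,
      ∀ ω, 𝒮.sourceLaw (π ω) = 𝒮.sourceLaw ω ∧ 𝒮.X (D', π ω) = 𝒮.X (D, ω) ∧
        𝒮.Z k (D', π ω) = 𝒮.Z k (D, ω)) : 𝒮.DemandPrivate δ := by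
  classical
  intro k
  rcases isEmpty_or_nonempty (DemandMatrix N K L) with hD | ⟨⟨D₀⟩⟩
  · exact (zero_ne_one ((by simp : (0 : ℝ) = _).trans (𝒮.jointLaw_mem hδ).2)).elim
  refine mutualInfo_eq_zero_of_factors q (𝒮.jointLaw_mem hδ) _ _
    (fun a => ∏ j : {j : Fin K // j ≠ k}, δ j (a j))
    (fun y => δ k y.2.2 * ∑ ω, if 𝒮.X (D₀, ω) = y.1 ∧ 𝒮.Z k (D₀, ω) = y.2.1
      then 𝒮.sourceLaw ω else 0) ?_
  rintro a ⟨x, z, d⟩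
  have hlaw : ∀ D, (∑ ω, if 𝒮.X (D, ω) = x ∧ 𝒮.Z k (D, ω) = z then 𝒮.sourceLaw ω else 0)
      = ∑ ω, if 𝒮.X (D₀, ω) = x ∧ 𝒮.Z k (D₀, ω) = z then 𝒮.sourceLaw ω else 0 := by
    intro D
    obtain ⟨π, hπ⟩ := h k D D₀
    rw [← Equiv.sum_comp π (fun ω => if 𝒮.X (D₀, ω) = x ∧ 𝒮.Z k (D₀, ω) = z
      then 𝒮.sourceLaw ω else 0)]
    exact Finset.sum_congr rfl fun ω _ => by rw [(hπ ω).1, (hπ ω).2.1, (hπ ω).2.2]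
  unfold prob
  rw [Fintype.sum_prod_type]
  set Ds : DemandMatrix N K L := fun j => if hj : j = k then d else a ⟨j, hj⟩ with hDs
  rw [Fintype.sum_eq_single Ds]
  · have h1 : ∏ j, δ j (Ds j) = (∏ j : {j : Fin K // j ≠ k}, δ j (a j)) * δ k d := by
      rw [Fintype.prod_eq_mul_prod_subtype_ne _ k, mul_comm]
      congr 1
      · exact Finset.prod_congr rfl fun j _ => by simp [hDs, j.2]
      · simp [hDs]
    have h2 : (fun j : {j : Fin K // j ≠ k} => Ds j) = a := by
      funext j
      simp [hDs, j.2]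
    have h3 : Ds k = d := by simp [hDs]
    rw [← mul_assoc, ← h1, ← hlaw Ds, Finset.mul_sum]
    refine Finset.sum_congr rfl fun ω _ => ?_
    simp only [h2, h3, Prod.mk.injEq, true_and, and_true, jointLaw, mul_ite, mul_zero]
  · intro D hD
    refine Finset.sum_eq_zero fun ω _ => if_neg ?_
    simp only [Prod.mk.injEq]
    rintro ⟨h1, -, -, h2⟩
    refine hD (funext fun j => ?_)
    by_cases hj : j = k
    · subst hj
      simpa [hDs] using h2
    · simp [hDs, hj, ← h1]

end Scheme

end Laws

/-! ### The virtual-user scheme -/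

section VirtualUsers

/-- The virtual users: every user is accompanied by a stack of `B` virtual users. They are
ordered lexicographically, for the sake of the signs in the coded sums. -/
abbrev VUser (K B : ℕ) : Type := Fin K ×ₗ Fin B

/-- Labels of file pieces: a set of virtual users (those who cache the piece) and the number of
the piece among those with this set. -/
abbrev PieceLabel (K B : ℕ) : Type := Σ _ : Finset (VUser K B), ℕ

lemma exists_perm_comp_eq {α β : Type} [Finite β] (f g : α ↪ β) :
    ∃ π : Equiv.Perm β, ∀ x, π (f x) = g x := by
  classical
  refine ⟨((Equiv.ofInjective f f.2).symm.trans (Equiv.ofInjective g g.2)).extendSubtype,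
    fun x => ?_⟩
  rw [Equiv.extendSubtype_apply_of_mem _ _ (Set.mem_range_self x)]
  exact congrArg (fun y => (Equiv.ofInjective g g.2 y : β))
    ((Equiv.ofInjective f f.2).symm_apply_apply x)

lemma exists_perm_of_range_eq {α β : Type} [Finite α] (f g : α ↪ β)
    (h : Set.range f = Set.range g) : ∃ τ : Equiv.Perm α, ∀ x, f x = g (τ x) := by
  refine ⟨(Equiv.ofInjective f f.2).trans ((Equiv.setCongr h).trans
    (Equiv.ofInjective g g.2).symm), fun x => ?_⟩
  exact (Equiv.apply_ofInjective_symm g.2 ⟨f x, h ▸ Set.mem_range_self x⟩).symm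

/-- The demands of all users are contained in a set of `N̄` files, and each demand vector extends
to an enumeration of this set. -/
lemma exists_demand_extension {N K L : ℕ} (hB : L ≤ Nbar N K L) (D : DemandMatrix N K L) :
    ∃ a : Fin K → Fin (Nbar N K L) ↪ Fin N, (∀ k l, a k (Fin.castLE hB l) = D k l) ∧
      ∀ j k, Set.range (a j) = Set.range (a k) := by
  classical
  have hcard : (Finset.univ.biUnion fun k => Finset.univ.map (D k)).card ≤ Nbar N K L := by
    refine le_min ((Finset.card_le_univ _).trans_eq (Fintype.card_fin N)) ?_
    refine Finset.card_biUnion_le.trans ?_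
    simp
  obtain ⟨U, hU, hUc⟩ := Finset.exists_superset_card_eq hcard
    ((min_le_left _ _).trans_eq (Fintype.card_fin N).symm)
  have hDU : ∀ k l, D k l ∈ U := fun k l => hU (by
    simp only [Finset.mem_biUnion, Finset.mem_univ, true_and, Finset.mem_map]
    exact ⟨k, l, rfl⟩)
  let e : Fin (Nbar N K L) ≃ U := (U.equivFinOfCardEq hUc).symm
  have hπ : ∀ k, ∃ π : Equiv.Perm (Fin (Nbar N K L)), ∀ l,
      π (Fin.castLEEmb hB l) = e.symm ⟨D k l, hDU k l⟩ := fun k =>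
    exists_perm_comp_eq (Fin.castLEEmb hB) ⟨fun l => e.symm ⟨D k l, hDU k l⟩, fun l l' h => by
      simpa using h⟩
  choose π hπ using hπ
  refine ⟨fun k => ((π k).trans e).toEmbedding.trans (Function.Embedding.subtype _),
    fun k l => ?_, fun j k => ?_⟩
  · have := hπ k l
    simp only [Fin.castLEEmb_apply] at this
    simp [this]
  · have : ∀ k, Set.range (((π k).trans e).toEmbedding.trans (Function.Embedding.subtype _))
        = (U : Set (Fin N)) := fun k => by
      ext x
      constructor
      · rintro ⟨i, rfl⟩
        exact (e (π k i)).2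
      · intro hx
        exact ⟨(π k).symm (e.symm ⟨x, hx⟩), by simp⟩
    rw [this, this]

variable {N K L F B : ℕ}

/-- The virtual users of user `k` whose caches it holds, when its key is `s`. -/
def ownVUsers (hB : L ≤ B) (k : Fin K) (s : Equiv.Perm (Fin B)) : Finset (VUser K B) :=
  Finset.univ.image fun l : Fin L => toLex (k, s (Fin.castLE hB l))

/-- The leaders: the stack of virtual users of the first user. -/
def leaders (hK : 0 < K) : Finset (VUser K B) :=
  Finset.univ.image fun i : Fin B => toLex ((⟨0, hK⟩ : Fin K), i)

/-- The demands of the virtual users, relative to the library relabelled by `σ`. The demands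
`a j` of the stack of user `j` are permuted by its key. -/
def virtualDemand (a : Fin K → Fin B ↪ Fin N) (σ : Equiv.Perm (Fin N))
    (s : Fin K → Equiv.Perm (Fin B)) (v : VUser K B) : Fin N :=
  σ.symm (a (ofLex v).1 ((s (ofLex v).1).symm (ofLex v).2))

/-- The piece of the file `w` with a given label, when the symbol `i` of a file has the label
`pos i`. Pieces without a symbol of the file are filled up with `0`. -/
def piece {R : Type} [Zero R] (pos : Fin F → PieceLabel K B) (w : Fin F → R)
    (p : PieceLabel K B) : R :=
  Function.extend pos w 0 p

/-- A subpacketization of the files, with enumerations of the symbols to be cached and to be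
broadcast. -/
structure Layout (N K L F B : ℕ) (hB : L ≤ B) (hK : 0 < K) where
  /-- the label of each symbol of a file -/
  pos : Fin F → PieceLabel K B
  pos_injective : Function.Injective pos
  /-- the number of cached symbols -/
  cacheLen : ℕ
  /-- the number of broadcast symbols -/
  msgLen : ℕ
  /-- the file and the label of each cached symbol -/
  cacheIdx : Fin K → Equiv.Perm (Fin B) → Fin cacheLen → Fin N × PieceLabel K B
  /-- the set of virtual users, and the number within this set, of each broadcast symbol -/
  msgIdx : Fin msgLen → PieceLabel K B
  mem_cacheIdx : ∀ k s n i, (∃ v ∈ ownVUsers hB k s, v ∈ (pos i).1) →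
    (n, pos i) ∈ Set.range (cacheIdx k s)
  mem_msgIdx : ∀ T i, (∃ v ∈ leaders hK, v ∈ T) → (∃ v ∈ T, T.erase v = (pos i).1) →
    (⟨T, (pos i).2⟩ : PieceLabel K B) ∈ Set.range msgIdx

/-- The virtual-user scheme: all files are relabelled by a secret permutation, user `j` holds the
caches of the virtual users in positions chosen by its key, and the server broadcasts the coded
sums for all sets of virtual users that contain a leader, along with the virtual demands. -/
def virtualScheme (q : ℕ) {hB : L ≤ B} {hK : 0 < K} (Ψ : Layout N K L F B hB hK)
    (a : DemandMatrix N K L → Fin K → Fin B ↪ Fin N) : Scheme q N K L F where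
  Key _ := Equiv.Perm (Fin B)
  keyLaw _ _ := (Fintype.card (Equiv.Perm (Fin B)) : ℝ)⁻¹
  keyLaw_mem _ := uniform_mem_stdSimplex _
  Server := Equiv.Perm (Fin N)
  serverLaw _ := (Fintype.card (Equiv.Perm (Fin N)) : ℝ)⁻¹
  serverLaw_mem := uniform_mem_stdSimplex _
  Header := VUser K B → Fin N
  headerFintype := inferInstanceAs (Fintype (Fin K × Fin B → Fin N))
  cacheLen := Ψ.cacheLen
  msgLen := Ψ.msgLen
  cache k s σ W i := piece Ψ.pos (W (σ (Ψ.cacheIdx k s i).1)) (Ψ.cacheIdx k s i).2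
  encode D σ s W i := codedSum (virtualDemand (a D) σ s)
    (fun n S => piece Ψ.pos (W (σ n)) ⟨S, (Ψ.msgIdx i).2⟩) (Ψ.msgIdx i).1
  header D σ s := virtualDemand (a D) σ s

variable {q : ℕ} [NeZero q] {hB : L ≤ B} {hK : 0 < K} (Ψ : Layout N K L F B hB hK)
  (a : DemandMatrix N K L → Fin K → Fin B ↪ Fin N)

/-- Two sources with the same message, cache and demands of user `k` have the same demanded files:
the differences of their pieces satisfy linear equations that force them to vanish. -/
lemma virtualScheme_correct (ha : ∀ D k l, a D k (Fin.castLE hB l) = D k l)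
    (hr : ∀ D j k, Set.range (a D j) = Set.range (a D k)) (δ : Fin K → Demand N L → ℝ) :
    (virtualScheme q Ψ a).Correct δ := by
  intro k
  refine condEntropy_eq_zero_of_factors _ _ _ _ ?_
  rintro ⟨D, W, σ, s⟩ ⟨D', W', σ', s'⟩ h
  change Fin K → Equiv.Perm (Fin B) at s s'
  change Equiv.Perm (Fin N) at σ σ'
  have hmsg : (fun i => codedSum (virtualDemand (a D) σ s)
      (fun n S => piece Ψ.pos (W (σ n)) ⟨S, (Ψ.msgIdx i).2⟩) (Ψ.msgIdx i).1) =
      fun i => codedSum (virtualDemand (a D') σ' s')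
      (fun n S => piece Ψ.pos (W' (σ' n)) ⟨S, (Ψ.msgIdx i).2⟩) (Ψ.msgIdx i).1 :=
    congrArg (fun y => y.1.1) h
  have hg : virtualDemand (a D) σ s = virtualDemand (a D') σ' s' := congrArg (fun y => y.1.2) h
  have hcache : (fun i => piece Ψ.pos (W (σ (Ψ.cacheIdx k (s k) i).1)) (Ψ.cacheIdx k (s k) i).2)
      = fun i => piece Ψ.pos (W' (σ' (Ψ.cacheIdx k (s' k) i).1)) (Ψ.cacheIdx k (s' k) i).2 :=
    congrArg (fun y => y.2.2.1) h
  have hs : s k = s' k := congrArg (fun y => y.2.2.2) h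
  simp only [← hg] at hmsg
  simp only [← hs] at hcache
  set g := virtualDemand (a D) σ s with hgdef
  have hgk : ∀ l, W (σ (g (toLex (k, s k (Fin.castLE hB l))))) = W (D k l) := fun l => by
    simp [hgdef, virtualDemand, ha]
  have hgk' : ∀ l, W' (σ' (g (toLex (k, s k (Fin.castLE hB l))))) = W' (D' k l) := fun l => by
    rw [hg]
    simp [virtualDemand, ha, hs]
  have hinj : Set.InjOn g (leaders hK : Finset (VUser K B)) := by
    intro u hu v hv huv
    obtain ⟨i, -, rfl⟩ := Finset.mem_image.1 (Finset.mem_coe.1 hu)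
    obtain ⟨j, -, rfl⟩ := Finset.mem_image.1 (Finset.mem_coe.1 hv)
    simpa [hgdef, virtualDemand] using huv
  have hsurj : ∀ v, ∃ u ∈ (leaders hK : Finset (VUser K B)), g u = g v := by
    intro v
    obtain ⟨i, hi⟩ : a D (ofLex v).1 ((s (ofLex v).1).symm (ofLex v).2)
        ∈ Set.range (a D ⟨0, hK⟩) := by
      rw [hr D ⟨0, hK⟩ (ofLex v).1]
      exact Set.mem_range_self _
    refine ⟨toLex (⟨0, hK⟩, s ⟨0, hK⟩ i), Finset.mem_image_of_mem _ (Finset.mem_univ _), ?_⟩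
    simp [hgdef, virtualDemand, hi]
  funext l i
  -- the differences of the pieces in layer `t` of the two libraries
  set t := (Ψ.pos i).2 with ht
  set u : Fin N → Finset (VUser K B) → ZMod q := fun n S =>
    piece Ψ.pos (W (σ n)) ⟨S, t⟩ - piece Ψ.pos (W' (σ' n)) ⟨S, t⟩ with hu
  have hout : ∀ S, (∀ i', Ψ.pos i' ≠ ⟨S, t⟩) → ∀ n, u n S = 0 := fun S hS n => by
    have : ¬ ∃ i', Ψ.pos i' = ⟨S, t⟩ := fun ⟨i', h⟩ => hS i' h
    simp [hu, piece, Function.extend_apply' _ _ _ this]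
  have hx0 : ∀ T, (∃ v ∈ (leaders hK : Finset (VUser K B)), v ∈ T) → codedSum g u T = 0 := by
    intro T hT
    by_cases hex : ∃ i', ∃ v ∈ T, Ψ.pos i' = ⟨T.erase v, t⟩
    · obtain ⟨i', v, hv, hi'⟩ := hex
      obtain ⟨j, hj⟩ := Ψ.mem_msgIdx T i' hT ⟨v, hv, by rw [hi']⟩
      rw [hu, codedSum_sub, sub_eq_zero]
      have := congrFun hmsg j
      rw [hj, hi'] at this
      exact this
    · refine Finset.sum_eq_zero fun v hv => ?_
      rw [hout, mul_zero]
      exact fun i' h => hex ⟨i', v, hv, h⟩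
  have hO : ∀ c S, (∃ v ∈ ownVUsers hB k (s k), v ∈ S) → u c S = 0 := by
    intro c S hS
    by_cases hex : ∃ i', Ψ.pos i' = ⟨S, t⟩
    · obtain ⟨i', hi'⟩ := hex
      obtain ⟨j, hj⟩ := Ψ.mem_cacheIdx k (s k) c i' (by rw [hi']; exact hS)
      have := congrFun hcache j
      rw [hj, hi'] at this
      exact sub_eq_zero.2 this
    · exact hout S (fun i' h => hex ⟨i', h⟩) c
  have hz := eq_zero_of_codedSum g u (ownVUsers hB k (s k))
    (codedSum_eq_zero g u _ hinj hsurj hx0) hO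
    (v := toLex (k, s k (Fin.castLE hB l))) (Finset.mem_image_of_mem _ (Finset.mem_univ _))
    (Ψ.pos i).1
  rw [hu] at hz
  simp only [hgk, hgk'] at hz
  have hlab : (⟨(Ψ.pos i).1, t⟩ : PieceLabel K B) = Ψ.pos i := rfl
  rw [hlab, piece, piece, Ψ.pos_injective.extend_apply, Ψ.pos_injective.extend_apply,
    sub_eq_zero] at hz
  exact hz

/-- To pass from the demand matrix `D` to `D'`, compose `σ` with a permutation `θ` that carries the
demands of the stack of user `k` to the new ones, and adapt the keys of the other users. -/
lemma virtualScheme_demandPrivate (hr : ∀ D j k, Set.range (a D j) = Set.range (a D k))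
    {δ : Fin K → Demand N L → ℝ} (hδ : ∀ k, δ k ∈ stdSimplex ℝ (Demand N L)) :
    (virtualScheme q Ψ a).DemandPrivate δ := by
  refine Scheme.demandPrivate_of_perm _ hδ fun k D D' => ?_
  obtain ⟨θ, hθ⟩ := exists_perm_comp_eq (a D k) (a D' k)
  have hτ : ∀ j, ∃ τ : Equiv.Perm (Fin B), ∀ x, θ (a D j x) = a D' j (τ x) := fun j => by
    refine exists_perm_of_range_eq ((a D j).trans θ.toEmbedding) (a D' j) ?_
    have h1 : ∀ j, Set.range ((a D j).trans θ.toEmbedding) = θ '' Set.range (a D j) := fun j => by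
      rw [← Set.range_comp]; rfl
    have h2 : Set.range (a D' k) = θ '' Set.range (a D k) := by
      rw [← Set.range_comp]
      exact congrArg Set.range (funext fun x => (hθ x).symm)
    rw [h1, hr D j k, ← h2, hr D' k j]
  choose τ hτ using hτ
  have hτk : τ k = 1 := by
    ext x
    have := (hθ x).symm.trans (hτ k x)
    rw [← (a D' k).injective this]
    rfl
  -- relabel the library by `θ`, and adjust the secret permutation and the keys accordingly
  refine ⟨Equiv.prodCongr (Equiv.arrowCongr θ (Equiv.refl _))
    (Equiv.prodCongr (Equiv.mulLeft θ : Equiv.Perm (Equiv.Perm (Fin N)))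
      (Equiv.piCongrRight fun j => (Equiv.mulRight (τ j)⁻¹ : Equiv.Perm (Equiv.Perm (Fin B))))), ?_⟩
  rintro ⟨W, σ, s⟩
  change Fin K → Equiv.Perm (Fin B) at s
  change Equiv.Perm (Fin N) at σ
  have hW : ∀ n, W (θ.symm ((θ * σ) n)) = W (σ n) := fun n => by simp
  have hg : virtualDemand (a D') (θ * σ) (fun j => s j * (τ j)⁻¹) = virtualDemand (a D) σ s := by
    funext v
    have h1 : ∀ x, (θ * σ).symm x = σ.symm (θ.symm x) := fun x => rfl
    have h2 : ∀ j x, (s j * (τ j)⁻¹).symm x = τ j ((s j).symm x) := fun j x => rfl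
    simp only [virtualDemand, h1, h2, ← hτ, Equiv.symm_apply_apply]
  refine ⟨rfl, ?_, ?_⟩
  · refine Prod.ext ?_ hg
    funext i
    change codedSum (virtualDemand (a D') (θ * σ) (fun j => s j * (τ j)⁻¹))
      (fun n S => piece Ψ.pos (W (θ.symm ((θ * σ) n))) ⟨S, (Ψ.msgIdx i).2⟩) (Ψ.msgIdx i).1 = _
    rw [hg]
    simp only [hW]
    rfl
  · have hs : s k * (τ k)⁻¹ = s k := by rw [hτk]; simp
    refine Prod.ext ?_ hs
    funext i
    change piece Ψ.pos (W (θ.symm ((θ * σ) (Ψ.cacheIdx k (s k * (τ k)⁻¹) i).1)))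
      (Ψ.cacheIdx k (s k * (τ k)⁻¹) i).2 = _
    rw [hs, hW]
    rfl

end VirtualUsers

/-! ### Subpacketization -/

section Subpacketization

open Classical in
/-- The sets that meet `O`. -/
def meeting {V : Type} [Fintype V] (O : Finset V) : Finset (Finset V) :=
  Finset.univ.filter fun S => ∃ v ∈ O, v ∈ S

lemma mem_meeting {V : Type} [Fintype V] {O S : Finset V} :
    S ∈ meeting O ↔ ∃ v ∈ O, v ∈ S := by
  simp [meeting]

/-- Sets are counted by their size: of the `m.choose r` sets of size `r`, all but
`(m - #O).choose r` meet `O`. -/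
lemma sum_meeting {V : Type} [Fintype V] (O : Finset V) (f : ℕ → ℕ) :
    ∑ S ∈ meeting O, f S.card = ∑ r ∈ Finset.range (Fintype.card V + 1),
      ((Fintype.card V).choose r - (Fintype.card V - O.card).choose r) * f r := by
  classical
  have h1 : ∑ S : Finset V, f S.card
      = ∑ r ∈ Finset.range (Fintype.card V + 1), (Fintype.card V).choose r * f r := by
    have := Finset.sum_powerset_apply_card f (x := (Finset.univ : Finset V))
    simpa using this
  have h2 : ∑ S ∈ Finset.univ.filter (fun S : Finset V => ¬ ∃ v ∈ O, v ∈ S), f S.card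
      = ∑ r ∈ Finset.range (Fintype.card V + 1), (Fintype.card V - O.card).choose r * f r := by
    have h3 : Finset.univ.filter (fun S : Finset V => ¬ ∃ v ∈ O, v ∈ S) = (Oᶜ).powerset := by
      ext S
      simp only [Finset.mem_filter, Finset.mem_univ, true_and, Finset.mem_powerset, not_exists,
        not_and, Finset.subset_iff, Finset.mem_compl]
      exact ⟨fun h v hv hO => h v hO hv, fun h v hO hv => h hv hO⟩
    rw [h3, Finset.sum_powerset_apply_card f, Finset.card_compl]
    simp only [smul_eq_mul]
    refine Finset.sum_subset (fun r hr => ?_) fun r _ hr => ?_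
    · simp only [Finset.mem_range] at hr ⊢
      omega
    · rw [Nat.choose_eq_zero_of_lt (by simp only [Finset.mem_range] at hr; omega), zero_mul]
  have h4 := Finset.sum_filter_add_sum_filter_not Finset.univ
    (fun S : Finset V => ∃ v ∈ O, v ∈ S) (fun S => f S.card)
  rw [h1, h2] at h4
  simp only [Nat.sub_mul]
  rw [Finset.sum_tsub_distrib]
  · simp only [meeting]
    omega
  · intro r _
    exact Nat.mul_le_mul_right _ (Nat.choose_le_choose r (Nat.sub_le _ _))

variable {N K L F B : ℕ}

lemma card_VUser : Fintype.card (VUser K B) = K * B := by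
  rw [Fintype.card_lex, Fintype.card_prod, Fintype.card_fin, Fintype.card_fin]

lemma card_ownVUsers (hB : L ≤ B) (k : Fin K) (s : Equiv.Perm (Fin B)) :
    (ownVUsers hB k s).card = L := by
  rw [ownVUsers, Finset.card_image_of_injective, Finset.card_univ, Fintype.card_fin]
  intro l l' h
  simpa using h

lemma card_leaders (hK : 0 < K) : (leaders hK : Finset (VUser K B)).card = B := by
  rw [leaders, Finset.card_image_of_injective, Finset.card_univ, Fintype.card_fin]
  intro i j h
  simpa using h

/-- Subpacketization with `b r` pieces for each set of `r` virtual users: the number of cached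
symbols and of broadcast symbols. -/
lemma exists_layout (N : ℕ) (hB : L ≤ B) (hK : 0 < K) (b : ℕ → ℕ)
    (hF : F ≤ ∑ r ∈ Finset.range (K * B + 1), (K * B).choose r * b r) :
    ∃ Ψ : Layout N K L F B hB hK,
      Ψ.cacheLen = N * ∑ r ∈ Finset.range (K * B + 1),
        ((K * B).choose r - (K * B - L).choose r) * b r ∧
      Ψ.msgLen = ∑ r ∈ Finset.range (K * B + 1),
        ((K * B).choose (r + 1) - (K * B - B).choose (r + 1)) * b r := by
  classical
  let labels : Finset (PieceLabel K B) := Finset.univ.sigma fun S => Finset.range (b S.card)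
  have hlabels : F ≤ labels.card := by
    rw [Finset.card_sigma]
    simp only [Finset.card_range]
    have := Finset.sum_powerset_apply_card b (x := (Finset.univ : Finset (VUser K B)))
    rw [Finset.powerset_univ, Finset.card_univ, card_VUser] at this
    rw [this]
    simpa using hF
  let pos : Fin F → PieceLabel K B := fun i => (labels.equivFin.symm (Fin.castLE hlabels i)).1
  have hpos : ∀ i, (pos i).2 < b (pos i).1.card := fun i => by
    exact Finset.mem_range.1
      (Finset.mem_sigma.1 (labels.equivFin.symm (Fin.castLE hlabels i)).2).2
  let cacheSet : Fin K → Equiv.Perm (Fin B) → Finset (Fin N × PieceLabel K B) := fun k s =>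
    Finset.univ ×ˢ (meeting (ownVUsers hB k s)).sigma fun S => Finset.range (b S.card)
  have hcache : ∀ k s, (cacheSet k s).card = N * ∑ r ∈ Finset.range (K * B + 1),
        ((K * B).choose r - (K * B - L).choose r) * b r := fun k s => by
    rw [Finset.card_product, Finset.card_univ, Fintype.card_fin, Finset.card_sigma]
    simp only [Finset.card_range]
    rw [sum_meeting, card_VUser, card_ownVUsers]
  let msgSet : Finset (PieceLabel K B) :=
    (meeting (leaders hK)).sigma fun T => Finset.range (b (T.card - 1))
  have hmsg : msgSet.card = ∑ r ∈ Finset.range (K * B + 1),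
        ((K * B).choose (r + 1) - (K * B - B).choose (r + 1)) * b r := by
    rw [Finset.card_sigma]
    simp only [Finset.card_range]
    rw [sum_meeting (leaders hK) (fun r => b (r - 1)), card_VUser, card_leaders,
      Finset.sum_range_succ', Finset.sum_range_succ]
    simp
  refine ⟨⟨pos, ?_, _, _, fun k s i => ((cacheSet k s).equivFinOfCardEq (hcache k s)).symm i,
    fun i => (msgSet.equivFinOfCardEq hmsg).symm i, ?_, ?_⟩, rfl, rfl⟩
  · intro i j h
    simpa using labels.equivFin.symm.injective (Subtype.ext h)
  · intro k s n i hi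
    have hm : (n, pos i) ∈ cacheSet k s := by
      simp only [cacheSet, Finset.mem_product, Finset.mem_univ, true_and, Finset.mem_sigma,
        mem_meeting, Finset.mem_range]
      exact ⟨hi, hpos i⟩
    exact ⟨(cacheSet k s).equivFinOfCardEq (hcache k s) ⟨_, hm⟩, by simp⟩
  · rintro T i hT ⟨v, hv, hvT⟩
    have hm : (⟨T, (pos i).2⟩ : PieceLabel K B) ∈ msgSet := by
      simp only [msgSet, Finset.mem_sigma, mem_meeting, Finset.mem_range]
      refine ⟨hT, ?_⟩
      have h1 := hpos i
      rwa [← hvT, Finset.card_erase_of_mem hv] at h1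
    exact ⟨msgSet.equivFinOfCardEq hmsg ⟨_, hm⟩, by simp⟩

end Subpacketization

/-! ### Achievability of the convex hull -/

section Achievability

variable {q N K L : ℕ}

lemma le_Nbar (hK : 0 < K) (hLN : L ≤ N) : L ≤ Nbar N K L :=
  le_min hLN (Nat.le_mul_of_pos_left L hK)

/-- The points of the convex hull of the memory-rate pairs of the proposed scheme are convex
combinations of these pairs. -/
lemma exists_weights_of_mem_convexHull {N K L : ℕ} {p : ℝ × ℝ}
    (hp : p ∈ convexHull ℝ (schemePoint N K L '' Set.Icc 0 (K * Nbar N K L))) :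
    ∃ w : ℕ → ℝ, (∀ r, 0 ≤ w r) ∧ ∑ r ∈ Finset.range (K * Nbar N K L + 1), w r = 1 ∧
      p = ∑ r ∈ Finset.range (K * Nbar N K L + 1), w r • schemePoint N K L r := by
  classical
  set m := K * Nbar N K L
  refine convexHull_min (t := {p | ∃ w : ℕ → ℝ, (∀ r, 0 ≤ w r) ∧
    ∑ r ∈ Finset.range (m + 1), w r = 1 ∧
      p = ∑ r ∈ Finset.range (m + 1), w r • schemePoint N K L r}) ?_ ?_ hp
  · rintro _ ⟨r, hr, rfl⟩
    have hr' : r ∈ Finset.range (m + 1) := Finset.mem_range.2 (Nat.lt_succ_of_le hr.2)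
    refine ⟨Pi.single r 1, fun i => ?_, ?_, ?_⟩
    · by_cases h : i = r
      · subst h; simp
      · simp [h]
    · rw [Finset.sum_eq_single_of_mem r hr' fun i _ hi => by simp [hi]]
      simp
    · rw [Finset.sum_eq_single_of_mem r hr' fun i _ hi => by simp [hi]]
      simp
  · rintro _ ⟨w, hw0, hw1, rfl⟩ _ ⟨w', hw0', hw1', rfl⟩ x y hx hy hxy
    refine ⟨fun r => x * w r + y * w' r, fun r => ?_, ?_, ?_⟩
    · have := hw0 r
      have := hw0' r
      positivity
    · rw [Finset.sum_add_distrib, ← Finset.mul_sum, ← Finset.mul_sum, hw1, hw1', mul_one, mul_one,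
        hxy]
    · simp only [Finset.smul_sum, add_smul, mul_smul, Finset.sum_add_distrib]

/-- Memory-sharing: all convex combinations of the memory-rate pairs of the proposed scheme are
achievable. The pieces for different `r` share the keys, the secret permutation and the header. -/
lemma achievable_of_mem_convexHull [Fact q.Prime] (hK : 0 < K) (hLN : L ≤ N)
    (δ : Fin K → Demand N L → ℝ) (hδ : ∀ k, δ k ∈ stdSimplex ℝ (Demand N L)) {M R : ℝ}
    (h : (M, R) ∈ convexHull ℝ (schemePoint N K L '' Set.Icc 0 (K * Nbar N K L))) :
    Achievable q N K L δ M R := by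
  have hq : 1 < q := (Fact.out : q.Prime).one_lt
  have hB := le_Nbar hK hLN
  obtain ⟨w, hw0, hw1, hw⟩ := exists_weights_of_mem_convexHull h
  choose a ha hr using fun D => exists_demand_extension hB D
  have hsub : (K - 1) * Nbar N K L = K * Nbar N K L - Nbar N K L := by
    rw [Nat.sub_mul, one_mul]
  simp only [schemePoint, hsub, Prod.ext_iff, Prod.fst_sum, Prod.snd_sum, Prod.smul_fst,
    Prod.smul_snd, smul_eq_mul] at hw
  obtain ⟨hM, hR⟩ := hw
  set m := K * Nbar N K L
  -- the numbers of cached and of broadcast pieces, for each file and each number of the piece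
  set c₁ : ℕ → ℝ := fun r => (m.choose r : ℝ) - ((m - L).choose r : ℝ) with hc₁
  set c₂ : ℕ → ℝ := fun r => (m.choose (r + 1) : ℝ) - ((m - Nbar N K L).choose (r + 1) : ℝ) with hc₂
  have hc₁0 : ∀ r, 0 ≤ c₁ r := fun r =>
    sub_nonneg.2 (by exact_mod_cast Nat.choose_le_choose r (Nat.sub_le _ _))
  have hc₂0 : ∀ r, 0 ≤ c₂ r := fun r =>
    sub_nonneg.2 (by exact_mod_cast Nat.choose_le_choose (r + 1) (Nat.sub_le _ _))
  intro ε hε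
  obtain ⟨F₀, hF₀⟩ := exists_nat_ge
    ((N * ∑ r ∈ Finset.range (m + 1), c₁ r + ∑ r ∈ Finset.range (m + 1), c₂ r
      + |Real.logb q (Fintype.card (Equiv.Perm (Fin (Nbar N K L))))|
      + |Real.logb q (Fintype.card (VUser K (Nbar N K L) → Fin N))|) / ε)
  refine ⟨F₀, fun F hF => ?_⟩
  have hF' := (div_le_iff₀ hε).1 (hF₀.trans (Nat.cast_le.2 hF))
  have hs₁ : 0 ≤ N * ∑ r ∈ Finset.range (m + 1), c₁ r :=
    mul_nonneg (Nat.cast_nonneg _) (Finset.sum_nonneg fun r _ => hc₁0 r)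
  have hs₂ : 0 ≤ ∑ r ∈ Finset.range (m + 1), c₂ r := Finset.sum_nonneg fun r _ => hc₂0 r
  have ha₁ := abs_nonneg (Real.logb q (Fintype.card (Equiv.Perm (Fin (Nbar N K L)))))
  have ha₂ := abs_nonneg (Real.logb q (Fintype.card (VUser K (Nbar N K L) → Fin N)))
  set b : ℕ → ℕ := fun r => ⌈w r * F / m.choose r⌉₊ with hb
  have hbF : F ≤ ∑ r ∈ Finset.range (m + 1), m.choose r * b r := by
    have : (F : ℝ) ≤ ∑ r ∈ Finset.range (m + 1), (m.choose r : ℝ) * b r := by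
      calc (F : ℝ) = ∑ r ∈ Finset.range (m + 1), w r * F := by
            rw [← Finset.sum_mul, hw1, one_mul]
        _ ≤ _ := by
            refine Finset.sum_le_sum fun r hr => ?_
            have hpos : (0 : ℝ) < m.choose r := by
              exact_mod_cast Nat.choose_pos (Nat.lt_succ_iff.1 (Finset.mem_range.1 hr))
            rw [mul_comm (m.choose r : ℝ), ← div_le_iff₀ hpos]
            exact Nat.le_ceil _
    exact_mod_cast this
  have hb_le : ∀ r, (b r : ℝ) ≤ w r * F / m.choose r + 1 := fun r =>
    (Nat.ceil_lt_add_one (div_nonneg (mul_nonneg (hw0 r) (Nat.cast_nonneg _))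
      (Nat.cast_nonneg _))).le
  have hsum_le : ∀ c : ℕ → ℝ, (∀ r, 0 ≤ c r) →
      ∑ r ∈ Finset.range (m + 1), c r * b r
        ≤ (∑ r ∈ Finset.range (m + 1), w r * (c r / m.choose r)) * F
          + ∑ r ∈ Finset.range (m + 1), c r := fun c hc => by
    rw [Finset.sum_mul, ← Finset.sum_add_distrib]
    refine Finset.sum_le_sum fun r _ => (mul_le_mul_of_nonneg_left (hb_le r) (hc r)).trans_eq ?_
    ring
  obtain ⟨Ψ, hΨc, hΨm⟩ := exists_layout N hB hK b hbF
  have hcl : (Ψ.cacheLen : ℝ) ≤ (M + ε) * F := by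
    have h1 : (Ψ.cacheLen : ℝ) = N * ∑ r ∈ Finset.range (m + 1), c₁ r * b r := by
      rw [hΨc]
      push_cast
      congr 1
      refine Finset.sum_congr rfl fun r _ => ?_
      rw [Nat.cast_sub (Nat.choose_le_choose r (Nat.sub_le _ _))]
    have h2 : M = N * ∑ r ∈ Finset.range (m + 1), w r * (c₁ r / m.choose r) := by
      rw [hM, Finset.mul_sum]
      exact Finset.sum_congr rfl fun r _ => by ring
    have h3 := mul_le_mul_of_nonneg_left (hsum_le c₁ hc₁0) (Nat.cast_nonneg (α := ℝ) N)
    rw [h1, add_mul, h2]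
    linarith
  have hml : (Ψ.msgLen : ℝ) ≤ (R + ε) * F := by
    have h1 : (Ψ.msgLen : ℝ) = ∑ r ∈ Finset.range (m + 1), c₂ r * b r := by
      rw [hΨm]
      push_cast
      refine Finset.sum_congr rfl fun r _ => ?_
      rw [Nat.cast_sub (Nat.choose_le_choose (r + 1) (Nat.sub_le _ _))]
    have h3 := hsum_le c₂ hc₂0
    rw [h1, add_mul, hR]
    linarith
  refine ⟨virtualScheme q Ψ a, ⟨hcl, fun k => ?_⟩, ⟨hml, fun D => ?_⟩, ⟨fun k => ?_, ?_⟩,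
    virtualScheme_correct Ψ a ha hr δ, virtualScheme_demandPrivate Ψ a hr hδ⟩
  · exact (entropy_vector_le hq (Scheme.sourceLaw_mem _) _).trans hcl
  · exact (entropy_vector_le hq (Scheme.sourceLaw_mem _) _).trans hml
  · change Real.logb q (Fintype.card (Equiv.Perm (Fin (Nbar N K L)))) ≤ ε * F
    have := le_abs_self (Real.logb q (Fintype.card (Equiv.Perm (Fin (Nbar N K L)))))
    linarith
  · have h1 : Real.logb q (Fintype.card (virtualScheme q Ψ a).Header)
        = Real.logb q (Fintype.card (VUser K (Nbar N K L) → Fin N)) := by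
      congr 2
    rw [h1]
    have := le_abs_self (Real.logb q (Fintype.card (VUser K (Nbar N K L) → Fin N)))
    linarith

end Achievability

/-! ### Shearer's inequality -/

section Shearer

variable {Ω α β γ : Type}

open Classical in
/-- The number of elements of `s` on which `f` takes the same value as on `ω`. For `ω` uniform
on `s`, the entropy of `f` is the mean of `log (#s / fiberCard s f ω)`. -/
def fiberCard (s : Finset Ω) (f : Ω → α) (ω : Ω) : ℕ := (s.filter fun x => f x = f ω).card

lemma fiberCard_pos {s : Finset Ω} (f : Ω → α) {ω : Ω} (h : ω ∈ s) : 0 < fiberCard s f ω :=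
  Finset.card_pos.2 ⟨ω, by simp [h]⟩

lemma fiberCard_congr (s : Finset Ω) {f : Ω → α} {ω x : Ω} (h : f x = f ω) :
    fiberCard s f x = fiberCard s f ω := by
  unfold fiberCard
  rw [h]

lemma fiberCard_mono {s : Finset Ω} {f : Ω → α} {g : Ω → β} {ω : Ω}
    (h : ∀ x ∈ s, f x = f ω → g x = g ω) : fiberCard s f ω ≤ fiberCard s g ω := by
  classical
  unfold fiberCard
  refine Finset.card_le_card fun x hx => ?_
  rw [Finset.mem_filter] at hx ⊢
  exact ⟨hx.1, h x hx.1 hx.2⟩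

lemma fiberCard_eq_of_iff {s : Finset Ω} {f : Ω → α} {g : Ω → β} {ω : Ω}
    (h : ∀ x, f x = f ω ↔ g x = g ω) : fiberCard s f ω = fiberCard s g ω :=
  le_antisymm (fiberCard_mono fun x _ => (h x).1) (fiberCard_mono fun x _ => (h x).2)

lemma fiberCard_eq_card {s : Finset Ω} {f : Ω → α} {ω : Ω} (h : ∀ x ∈ s, f x = f ω) :
    fiberCard s f ω = s.card := by
  classical
  rw [fiberCard, Finset.filter_true_of_mem h]

lemma fiberCard_eq_one {s : Finset Ω} {f : Ω → α} {ω : Ω} (hω : ω ∈ s)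
    (h : ∀ x ∈ s, f x = f ω → x = ω) : fiberCard s f ω = 1 := by
  classical
  exact Finset.card_eq_one.2 ⟨ω, Finset.eq_singleton_iff_unique_mem.2
    ⟨Finset.mem_filter.2 ⟨hω, rfl⟩, fun x hx =>
      h x (Finset.mem_filter.1 hx).1 (Finset.mem_filter.1 hx).2⟩⟩

lemma sum_inv_fiberCard_le_one (s : Finset Ω) (f : Ω → α) (a : α)
    [DecidablePred fun ω => f ω = a] :
    ∑ ω ∈ s.filter (fun ω => f ω = a), (fiberCard s f ω : ℝ)⁻¹ ≤ 1 := by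
  have h : ∀ ω ∈ s.filter (fun ω => f ω = a), (fiberCard s f ω : ℝ)⁻¹
      = ((s.filter (fun ω => f ω = a)).card : ℝ)⁻¹ := fun ω hω => by
    rw [fiberCard, (Finset.mem_filter.1 hω).2]
    congr
  rw [Finset.sum_congr rfl h, Finset.sum_const, nsmul_eq_mul]
  exact mul_inv_le_one

/-- Submodularity of the entropy, in the form `H(f, g, h) + H(f) ≤ H(f, g) + H(f, h)`. -/
lemma sum_log_fiberCard_submodular (s : Finset Ω) (f : Ω → α) (g : Ω → β) (h : Ω → γ) :
    ∑ ω ∈ s, Real.log (fiberCard s (fun ω => (f ω, g ω)) ω)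
      + ∑ ω ∈ s, Real.log (fiberCard s (fun ω => (f ω, h ω)) ω)
      ≤ ∑ ω ∈ s, Real.log (fiberCard s (fun ω => (f ω, g ω, h ω)) ω)
        + ∑ ω ∈ s, Real.log (fiberCard s f ω) := by
  classical
  set n₁ : Ω → ℝ := fun ω => fiberCard s (fun ω => (f ω, g ω)) ω with hn₁
  set n₂ : Ω → ℝ := fun ω => fiberCard s (fun ω => (f ω, h ω)) ω with hn₂
  set n₃ : Ω → ℝ := fun ω => fiberCard s (fun ω => (f ω, g ω, h ω)) ω with hn₃
  set n₀ : Ω → ℝ := fun ω => fiberCard s f ω with hn₀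
  have p₁ : ∀ ω ∈ s, 0 < n₁ ω := fun ω hω => Nat.cast_pos.2 (fiberCard_pos _ hω)
  have p₂ : ∀ ω ∈ s, 0 < n₂ ω := fun ω hω => Nat.cast_pos.2 (fiberCard_pos _ hω)
  have p₃ : ∀ ω ∈ s, 0 < n₃ ω := fun ω hω => Nat.cast_pos.2 (fiberCard_pos _ hω)
  have p₀ : ∀ ω ∈ s, 0 < n₀ ω := fun ω hω => Nat.cast_pos.2 (fiberCard_pos _ hω)
  have hlog : ∀ ω ∈ s, Real.log (n₁ ω) + Real.log (n₂ ω) - Real.log (n₃ ω) - Real.log (n₀ ω)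
      ≤ n₁ ω * n₂ ω * (n₃ ω)⁻¹ * (n₀ ω)⁻¹ - 1 := fun ω hω => by
    have a₁ := p₁ ω hω
    have a₂ := p₂ ω hω
    have a₃ := p₃ ω hω
    have a₀ := p₀ ω hω
    refine le_trans (le_of_eq ?_) (Real.log_le_sub_one_of_pos (by positivity))
    rw [Real.log_mul (by positivity) (by positivity), Real.log_mul (by positivity) (by positivity),
      Real.log_mul a₁.ne' a₂.ne', Real.log_inv, Real.log_inv]
    ring
  -- count triples `(ω, x, y)` with `x` agreeing with `ω` on `(f, g)` and `y` on `(f, h)`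
  have hcount : ∑ ω ∈ s, n₁ ω * n₂ ω * (n₃ ω)⁻¹ * (n₀ ω)⁻¹ ≤ s.card := by
    have e₁ : ∀ ω ∈ s, n₁ ω * n₂ ω * (n₃ ω)⁻¹ * (n₀ ω)⁻¹ = ∑ x ∈ s, ∑ y ∈ s,
        if (f x, g x) = (f ω, g ω) ∧ (f y, h y) = (f ω, h ω) then (n₃ ω)⁻¹ * (n₀ x)⁻¹ else 0 := by
      intro ω _
      have c₁ : n₁ ω = ∑ x ∈ s, if (f x, g x) = (f ω, g ω) then (1 : ℝ) else 0 := by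
        simp only [hn₁, fiberCard, Finset.sum_boole]
      have c₂ : n₂ ω = ∑ y ∈ s, if (f y, h y) = (f ω, h ω) then (1 : ℝ) else 0 := by
        simp only [hn₂, fiberCard, Finset.sum_boole]
      rw [c₁, c₂, Finset.sum_mul_sum, mul_assoc, Finset.sum_mul]
      refine Finset.sum_congr rfl fun x _ => ?_
      rw [Finset.sum_mul]
      refine Finset.sum_congr rfl fun y _ => ?_
      by_cases hx : (f x, g x) = (f ω, g ω)
      · have h0 : n₀ x = n₀ ω := by
          simp only [hn₀]
          rw [fiberCard_congr s (Prod.ext_iff.1 hx).1]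
        by_cases hy : (f y, h y) = (f ω, h ω)
        · rw [if_pos hx, if_pos hy, if_pos ⟨hx, hy⟩, h0, one_mul, one_mul]
        · rw [if_neg hy, if_neg fun h' : _ ∧ _ => hy h'.2, mul_zero, zero_mul]
      · rw [if_neg hx, if_neg fun h' : _ ∧ _ => hx h'.1, zero_mul, zero_mul]
    rw [Finset.sum_congr rfl e₁, Finset.sum_comm, Finset.card_eq_sum_ones, Nat.cast_sum]
    refine Finset.sum_le_sum fun x hx => ?_
    rw [Finset.sum_comm]
    calc ∑ y ∈ s, ∑ ω ∈ s, (if (f x, g x) = (f ω, g ω) ∧ (f y, h y) = (f ω, h ω)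
          then (n₃ ω)⁻¹ * (n₀ x)⁻¹ else 0)
        ≤ ∑ y ∈ s, if f y = f x then (n₀ x)⁻¹ else 0 := by
          refine Finset.sum_le_sum fun y _ => ?_
          by_cases hxy : f y = f x
          · rw [if_pos hxy]
            have h1 := sum_inv_fiberCard_le_one s (fun ω => (f ω, g ω, h ω)) (f x, g x, h y)
            rw [← Finset.sum_filter, ← Finset.sum_mul]
            refine (mul_le_mul_of_nonneg_right ?_ (inv_nonneg.2 (p₀ x hx).le)).trans_eq (one_mul _)
            refine le_trans (le_of_eq (Finset.sum_congr ?_ fun _ _ => rfl)) h1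
            refine Finset.filter_congr fun ω _ => ?_
            simp only [Prod.mk.injEq]
            constructor
            · rintro ⟨⟨h1, h2⟩, -, h3⟩
              exact ⟨h1.symm, h2.symm, h3.symm⟩
            · rintro ⟨h1, h2, h3⟩
              exact ⟨⟨h1.symm, h2.symm⟩, hxy.trans h1.symm, h3.symm⟩
          · rw [if_neg hxy]
            refine (Finset.sum_eq_zero fun ω _ => if_neg ?_).le
            simp only [Prod.mk.injEq]
            rintro ⟨⟨h1, -⟩, h2, -⟩
            exact hxy (h2.trans h1.symm)
      _ = (1 : ℕ) := by
          rw [← Finset.sum_filter, Finset.sum_const, nsmul_eq_mul, Nat.cast_one]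
          exact mul_inv_cancel₀ (p₀ x hx).ne'
  have := Finset.sum_le_sum hlog
  simp only [Finset.sum_sub_distrib, Finset.sum_add_distrib, Finset.sum_const, nsmul_eq_mul,
    mul_one] at this
  linarith

/-- The entropy is at most the logarithm of the size of the alphabet. -/
lemma card_mul_log_card_le [Fintype α] (s : Finset Ω) (f : Ω → α) :
    (s.card : ℝ) * Real.log s.card
      ≤ ∑ ω ∈ s, Real.log (fiberCard s f ω) + s.card * Real.log (Fintype.card α) := by
  classical
  rcases s.eq_empty_or_nonempty with rfl | ⟨ω₀, hω₀⟩
  · simp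
  have hs : (0 : ℝ) < s.card := by exact_mod_cast Finset.card_pos.2 ⟨ω₀, hω₀⟩
  have hα : (0 : ℝ) < Fintype.card α := by
    exact_mod_cast Fintype.card_pos_iff.2 ⟨f ω₀⟩
  have hlog : ∀ ω ∈ s, Real.log s.card - Real.log (Fintype.card α)
      - Real.log (fiberCard s f ω) ≤ s.card / Fintype.card α * (fiberCard s f ω : ℝ)⁻¹ - 1 := by
    intro ω hω
    have hf : (0 : ℝ) < fiberCard s f ω := by exact_mod_cast fiberCard_pos f hω
    refine le_trans (le_of_eq ?_) (Real.log_le_sub_one_of_pos (by positivity))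
    rw [Real.log_mul (by positivity) (by positivity), Real.log_div hs.ne' hα.ne', Real.log_inv]
    ring
  have hcount : ∑ ω ∈ s, (fiberCard s f ω : ℝ)⁻¹ ≤ Fintype.card α := by
    rw [← Finset.sum_fiberwise_of_maps_to (s := s) (t := Finset.univ) (g := f)
      fun _ _ => Finset.mem_univ _]
    exact (Finset.sum_le_sum fun a _ => sum_inv_fiberCard_le_one s f a).trans_eq (by simp)
  have h1 := Finset.sum_le_sum hlog
  simp only [Finset.sum_sub_distrib, ← Finset.mul_sum, Finset.sum_const, nsmul_eq_mul,
    mul_one] at h1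
  have h2 : (s.card : ℝ) / Fintype.card α * ∑ ω ∈ s, (fiberCard s f ω : ℝ)⁻¹ ≤ s.card := by
    calc _ ≤ (s.card : ℝ) / Fintype.card α * Fintype.card α := by gcongr
      _ = s.card := div_mul_cancel₀ _ hα.ne'
  linarith

variable {N : ℕ}

/-- The sum over `s` of the logarithms of the sizes of the classes of tuples that agree on `A`.
Up to normalization it is the entropy of the whole tuple given its restriction to `A`. -/
def classLog (s : Finset (Fin N → β)) (A : Finset (Fin N)) : ℝ :=
  ∑ ω ∈ s, Real.log (fiberCard s (fun (ω : Fin N → β) (i : A) => ω i) ω)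

lemma restrict_eq_iff {A : Finset (Fin N)} {x y : Fin N → β} :
    ((fun i : A => x i) = fun i : A => y i) ↔ ∀ i ∈ A, x i = y i := by
  simp [funext_iff]

/-- Conditioning reduces entropy: `A ⊆ A'` implies `H(ω n | ω A') ≤ H(ω n | ω A)`. -/
lemma classLog_insert_submodular (s : Finset (Fin N → β)) {A A' : Finset (Fin N)} (h : A ⊆ A')
    (n : Fin N) :
    classLog s A' - classLog s (insert n A') ≤ classLog s A - classLog s (insert n A) := by
  classical
  have key := sum_log_fiberCard_submodular s (fun (ω : Fin N → β) (i : A) => ω i) (fun ω => ω n)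
    (fun (ω : Fin N → β) (i : A') => ω i)
  have h1 : ∀ ω, fiberCard s (fun ω => ((fun i : A => ω i), ω n)) ω
      = fiberCard s (fun ω (i : (insert n A : Finset (Fin N))) => ω i) ω := fun ω => by
    refine fiberCard_eq_of_iff fun x => ?_
    rw [Prod.mk.injEq, restrict_eq_iff, restrict_eq_iff, Finset.forall_mem_insert, and_comm]
  have h2 : ∀ ω, fiberCard s (fun ω => ((fun i : A => ω i), fun i : A' => ω i)) ω
      = fiberCard s (fun ω (i : A') => ω i) ω := fun ω => by
    refine fiberCard_eq_of_iff fun x => ?_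
    rw [Prod.mk.injEq, restrict_eq_iff, restrict_eq_iff, and_iff_right_iff_imp]
    exact fun hA i hi => hA i (h hi)
  have h3 : ∀ ω, fiberCard s (fun ω => ((fun i : A => ω i), ω n, fun i : A' => ω i)) ω
      = fiberCard s (fun ω (i : (insert n A' : Finset (Fin N))) => ω i) ω := fun ω => by
    refine fiberCard_eq_of_iff fun x => ?_
    rw [Prod.mk.injEq, Prod.mk.injEq, restrict_eq_iff, restrict_eq_iff, restrict_eq_iff,
      Finset.forall_mem_insert, and_iff_right_iff_imp]
    exact fun hA i hi => hA.2 i (h hi)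
  simp only [h1, h2, h3] at key
  unfold classLog
  linarith

/-- The chain rule along the order of `Fin N`, where each coordinate of `A` is conditioned on all
earlier coordinates instead of the earlier ones in `A`. -/
lemma sum_classLog_sub_le (s : Finset (Fin N → β)) (A : Finset (Fin N)) :
    ∑ n ∈ A, (classLog s (Finset.univ.filter (· < n)) - classLog s (Finset.univ.filter (· ≤ n)))
      ≤ classLog s ∅ - classLog s A := by
  classical
  induction A using Finset.induction_on_max with
  | empty => simp
  | insert n A hA ih =>
    have hn : n ∉ A := fun h => lt_irrefl n (hA n h)
    rw [Finset.sum_insert hn]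
    have h1 := classLog_insert_submodular s (A := A) (A' := Finset.univ.filter (· < n))
      (fun x hx => by simpa using hA x hx) n
    have h2 : insert n (Finset.univ.filter (· < n)) = Finset.univ.filter (· ≤ n) := by
      ext x
      simp [le_iff_lt_or_eq, or_comm]
    rw [h2] at h1
    linarith

lemma classLog_empty (s : Finset (Fin N → β)) : classLog s ∅ = s.card * Real.log s.card := by
  have : ∀ ω, fiberCard s (fun (ω : Fin N → β) (i : (∅ : Finset (Fin N))) => ω i) ω = s.card :=
    fun ω => fiberCard_eq_card fun x _ => restrict_eq_iff.2 (by simp)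
  simp [classLog, this]

lemma classLog_univ (s : Finset (Fin N → β)) : classLog s Finset.univ = 0 := by
  refine Finset.sum_eq_zero fun ω hω => ?_
  rw [fiberCard_eq_one hω fun x _ hx => funext fun i => restrict_eq_iff.1 hx i (Finset.mem_univ i)]
  simp

lemma sum_classLog_univ (s : Finset (Fin N → β)) :
    ∑ n, (classLog s (Finset.univ.filter (· < n)) - classLog s (Finset.univ.filter (· ≤ n)))
      = s.card * Real.log s.card := by
  have h1 : ∀ n : Fin N, Finset.univ.filter (· < n)
      = Finset.univ.filter (fun x : Fin N => x.1 < n.1) := fun n => rfl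
  have h2 : ∀ n : Fin N, Finset.univ.filter (· ≤ n)
      = Finset.univ.filter (fun x : Fin N => x.1 < n.1 + 1) := fun n => by
    ext x
    simp only [Finset.mem_filter, Finset.mem_univ, true_and, Fin.le_def]
    omega
  simp only [h1, h2]
  rw [Fin.sum_univ_eq_sum_range (fun i => classLog s (Finset.univ.filter fun x : Fin N => x.1 < i)
    - classLog s (Finset.univ.filter fun x : Fin N => x.1 < i + 1)) N, Finset.sum_range_sub']
  have h3 : Finset.univ.filter (fun x : Fin N => x.1 < 0) = ∅ := by simp
  have h4 : Finset.univ.filter (fun x : Fin N => x.1 < N) = Finset.univ :=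
    Finset.filter_true_of_mem fun x _ => x.2
  rw [h3, h4, classLog_empty, classLog_univ, sub_zero]

/-- Shearer's inequality: if the sets `A j` cover every coordinate `c` times, and the
restriction of a tuple in `s` to `A j` is determined by a message `f j` from an alphabet of
size `#γ`, then `#s ^ c ≤ #γ ^ (number of sets)`. -/
lemma shearer [Fintype γ] {J : Type} [Fintype J] (s : Finset (Fin N → β)) (hs : s.Nonempty)
    (A : J → Finset (Fin N)) (c : ℕ) (hc : ∀ n, (Finset.univ.filter fun j => n ∈ A j).card = c)
    (f : J → (Fin N → β) → γ)
    (hf : ∀ j, ∀ x ∈ s, ∀ y ∈ s, f j x = f j y → ∀ i ∈ A j, x i = y i) :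
    c * Real.log s.card ≤ Fintype.card J * Real.log (Fintype.card γ) := by
  classical
  have hpos : (0 : ℝ) < s.card := by exact_mod_cast hs.card_pos
  have h1 : ∀ j, ∑ n ∈ A j, (classLog s (Finset.univ.filter (· < n))
      - classLog s (Finset.univ.filter (· ≤ n))) ≤ s.card * Real.log (Fintype.card γ) := by
    intro j
    refine (sum_classLog_sub_le s (A j)).trans ?_
    rw [classLog_empty]
    have h2 := card_mul_log_card_le s (f j)
    have h3 : ∑ ω ∈ s, Real.log (fiberCard s (f j) ω) ≤ classLog s (A j) := by
      refine Finset.sum_le_sum fun ω hω => Real.log_le_log ?_ ?_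
      · exact_mod_cast fiberCard_pos (f j) hω
      · exact_mod_cast fiberCard_mono fun x hx hfx =>
          restrict_eq_iff.2 fun i hi => hf j x hx ω hω hfx i hi
    linarith
  have h4 := Finset.sum_le_sum fun j (_ : j ∈ Finset.univ) => h1 j
  rw [Finset.sum_const, Finset.card_univ, nsmul_eq_mul] at h4
  have h5 : ∑ j, ∑ n ∈ A j, (classLog s (Finset.univ.filter (· < n))
      - classLog s (Finset.univ.filter (· ≤ n))) = c * (s.card * Real.log s.card) := by
    rw [Finset.sum_comm' (t' := Finset.univ) (s' := fun n => Finset.univ.filter fun j => n ∈ A j)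
      (by simp)]
    simp only [Finset.sum_const, hc, nsmul_eq_mul]
    rw [← Finset.mul_sum, sum_classLog_univ]
  rw [h5] at h4
  refine le_of_mul_le_mul_left ?_ hpos
  linarith

end Shearer

/-! ### The averaged cut-set bound -/

section Converse

variable {q N K L : ℕ}

lemma exists_pos_of_mem_stdSimplex {α : Type} [Fintype α] {p : α → ℝ} (hp : p ∈ stdSimplex ℝ α) :
    ∃ x, 0 < p x := by
  by_contra! h
  have := Finset.sum_nonpos fun x (_ : x ∈ Finset.univ) => h x
  rw [hp.2] at this
  linarith

/-- Given all keys and the server's randomness, the caches and the encoded symbols determine the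
demanded files. -/
lemma Scheme.Correct.exists_decodable {F : ℕ} [Fact q.Prime] {𝒮 : Scheme q N K L F}
    {δ : Fin K → Demand N L → ℝ} (hδ : ∀ k, δ k ∈ stdSimplex ℝ (Demand N L))
    (hδpos : ∀ k d, 0 < δ k d) (h𝒮 : 𝒮.Correct δ) :
    ∃ (p : 𝒮.Server) (s : ∀ k, 𝒮.Key k), ∀ (D : DemandMatrix N K L) (k : Fin K)
      (W W' : Library q N F), 𝒮.cache k (s k) p W = 𝒮.cache k (s k) p W' →
        𝒮.encode D p s W = 𝒮.encode D p s W' → ∀ l, W (D k l) = W' (D k l) := by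
  have hq : 1 < q := (Fact.out : q.Prime).one_lt
  obtain ⟨p, hp⟩ := exists_pos_of_mem_stdSimplex 𝒮.serverLaw_mem
  choose s hs using fun k => exists_pos_of_mem_stdSimplex (𝒮.keyLaw_mem k)
  have hpos : ∀ (D : DemandMatrix N K L) (W : Library q N F),
      0 < 𝒮.jointLaw δ (D, W, p, s) := fun D W =>
    mul_pos (Finset.prod_pos fun k _ => hδpos _ _) (mul_pos (mul_pos
      (inv_pos.2 (by exact_mod_cast Fintype.card_pos)) hp) (Finset.prod_pos fun k _ => hs k))
  refine ⟨p, s, fun D k W W' hc he l => ?_⟩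
  have := factors_of_condEntropy_eq_zero hq (𝒮.jointLaw_mem hδ).1 _ _ (h𝒮 k) (hpos D W) (hpos D W')
    (by simp only [Scheme.X, Scheme.Z, Scheme.msgSymbols, Scheme.cacheSymbols, hc, he])
  exact congrFun this l

/-- The averaged cut-set bound for one scheme. The caches of `i` users and the message for one
demand matrix determine `i L` files. The demands run through the `N` cyclic shifts of a window
of `i L` consecutive files, and Shearer's inequality combines the resulting bounds. -/
lemma Scheme.Correct.cutSet {F : ℕ} [Fact q.Prime] {𝒮 : Scheme q N K L F}
    {δ : Fin K → Demand N L → ℝ} (hδ : ∀ k, δ k ∈ stdSimplex ℝ (Demand N L))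
    (hδpos : ∀ k d, 0 < δ k d) (h𝒮 : 𝒮.Correct δ) (hN : 0 < N) (hLN : L ≤ N) {i : ℕ}
    (hiK : i ≤ K) (hiN : i * L ≤ N) :
    (i * L : ℝ) * (N * F - i * 𝒮.cacheLen) ≤ N * 𝒮.msgLen := by
  classical
  have hq : 1 < q := (Fact.out : q.Prime).one_lt
  have hq0 : (0 : ℝ) < q := by exact_mod_cast hq.le
  have hlog : 0 < Real.log q := Real.log_pos (by exact_mod_cast hq)
  have : NeZero N := ⟨hN.ne'⟩
  obtain ⟨p, s, hdec⟩ := h𝒮.exists_decodable hδ hδpos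
  -- many libraries share the caches of the first `i` users
  let caches : Library q N F → Fin i → Fin 𝒮.cacheLen → ZMod q := fun W u =>
    𝒮.cache (Fin.castLE hiK u) (s _) p W
  obtain ⟨z, -, hz⟩ := Finset.exists_le_card_fiber_of_nsmul_le_card_of_maps_to
    (s := Finset.univ) (t := Finset.univ) (f := caches)
    (b := (q : ℝ) ^ (N * F) / (q : ℝ) ^ (i * 𝒮.cacheLen))
    (fun _ _ => Finset.mem_univ _) Finset.univ_nonempty (by
      simp only [Finset.card_univ, Fintype.card_fun, Fintype.card_fin, ZMod.card, nsmul_eq_mul]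
      push_cast
      rw [← pow_mul, ← pow_mul, mul_comm 𝒮.cacheLen i, mul_comm F N,
        mul_div_cancel₀ _ (by positivity)])
  set fib : Finset (Library q N F) := Finset.univ.filter fun W => caches W = z with hfib
  have hb : (0 : ℝ) < (q : ℝ) ^ (N * F) / (q : ℝ) ^ (i * 𝒮.cacheLen) := by positivity
  have hne : fib.Nonempty := Finset.card_pos.1 (by exact_mod_cast hb.trans_le hz)
  have hlogfib : ((N * F : ℝ) - i * 𝒮.cacheLen) * Real.log q ≤ Real.log fib.card := by
    refine le_trans (le_of_eq ?_) (Real.log_le_log hb hz)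
    rw [Real.log_div (by positivity) (by positivity), Real.log_pow, Real.log_pow]
    push_cast
    ring
  let off : Fin i × Fin L → Fin N := fun x => Fin.castLE hiN (finProdFinEquiv x)
  have hoff : Function.Injective off := fun x y h =>
    finProdFinEquiv.injective (Fin.castLE_injective hiN h)
  let Dm : Fin N → DemandMatrix N K L := fun j k =>
    if hk : k.1 < i then ⟨fun l => j + off (⟨k, hk⟩, l), fun l l' h => by
      simpa using hoff (add_left_cancel h)⟩
    else ⟨fun l => j + Fin.castLE hLN l, fun l l' h =>
      Fin.castLE_injective hLN (add_left_cancel h)⟩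
  have hDm : ∀ j u l, Dm j (Fin.castLE hiK u) l = j + off (u, l) := fun j u l => by
    have hu : (Fin.castLE hiK u).1 < i := u.2
    simp only [Dm, dif_pos hu]
    rfl
  have hsh := shearer fib hne (fun j => Finset.univ.image fun x => j + off x) (i * L)
    (fun n => by
      have : Finset.univ.filter (fun j => n ∈ Finset.univ.image fun x => j + off x)
          = Finset.univ.image fun x => n - off x := by
        ext j
        simp only [Finset.mem_filter, Finset.mem_univ, true_and, Finset.mem_image]
        exact exists_congr fun x => by rw [sub_eq_iff_eq_add, eq_comm]
      rw [this, Finset.card_image_of_injective _ fun x y h => hoff (sub_right_injective h)]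
      simp)
    (fun j W => 𝒮.encode (Dm j) p s W)
    (fun j W hW W' hW' he n hn => by
      obtain ⟨⟨u, l⟩, -, rfl⟩ := Finset.mem_image.1 hn
      rw [← hDm]
      have hc : caches W = caches W' :=
        (Finset.mem_filter.1 hW).2.trans (Finset.mem_filter.1 hW').2.symm
      exact hdec _ _ W W' (congrFun hc u) he l)
  rw [Fintype.card_fin, Fintype.card_fun, Fintype.card_fin, ZMod.card, Nat.cast_pow, Real.log_pow]
    at hsh
  have h1 := (mul_le_mul_of_nonneg_left hlogfib (Nat.cast_nonneg (i * L))).trans hsh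
  push_cast at h1
  refine le_of_mul_le_mul_right ?_ hlog
  linarith

/-- The averaged cut-set bound: `R ≥ i L (1 - i M / N)`. -/
lemma Achievable.cutSet [Fact q.Prime] {δ : Fin K → Demand N L → ℝ}
    (hδ : ∀ k, δ k ∈ stdSimplex ℝ (Demand N L)) (hδpos : ∀ k d, 0 < δ k d) {M R : ℝ}
    (h : Achievable q N K L δ M R) (hN : 0 < N) (hLN : L ≤ N) {i : ℕ}
    (hiK : i ≤ K) (hiN : i * L ≤ N) : (i * L : ℝ) * (N - i * M) ≤ N * R := by
  have key : ∀ ε : ℝ, 0 < ε → (i * L : ℝ) * (N - i * (M + ε)) ≤ N * (R + ε) := by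
    intro ε hε
    obtain ⟨F₀, hF₀⟩ := h ε hε
    obtain ⟨𝒮, hM, hR, -, hc, -⟩ := hF₀ (F₀ + 1) (Nat.le_succ _)
    have hF : (0 : ℝ) < (F₀ + 1 : ℕ) := by positivity
    have h1 := hc.cutSet hδ hδpos hN hLN hiK hiN
    refine le_of_mul_le_mul_right ?_ hF
    calc (i * L : ℝ) * (N - i * (M + ε)) * (F₀ + 1 : ℕ)
        = (i * L : ℝ) * (N * (F₀ + 1 : ℕ) - i * ((M + ε) * (F₀ + 1 : ℕ))) := by ring
      _ ≤ (i * L : ℝ) * (N * (F₀ + 1 : ℕ) - i * 𝒮.cacheLen) := by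
          gcongr
          exact hM.1
      _ ≤ N * 𝒮.msgLen := h1
      _ ≤ N * ((R + ε) * (F₀ + 1 : ℕ)) := by
          gcongr
          exact hR.1
      _ = N * (R + ε) * (F₀ + 1 : ℕ) := by ring
  have hC : (0 : ℝ) < N + i * L * i := by
    have : (0 : ℝ) < N := by exact_mod_cast hN
    positivity
  refine le_of_forall_pos_le_add fun η hη => ?_
  have h1 := key (η / (N + i * L * i)) (div_pos hη hC)
  have h2 : (N + i * L * i : ℝ) * (η / (N + i * L * i)) = η := mul_div_cancel₀ _ hC.ne'
  linarith

end Converse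

/-! ### The lower convex envelope -/

section Envelope

/-- Union bound: at most a fraction `L r / m` of the `r`-subsets of an `m`-set meets a given
`L`-subset. -/
lemma mul_choose_le_mul_choose_sub_add {m L : ℕ} (hL : L ≤ m) (r : ℕ) :
    m * m.choose r ≤ m * (m - L).choose r + L * r * m.choose r := by
  induction L with
  | zero => simp
  | succ L ih =>
    have ih := ih (by omega)
    rcases r with _ | r
    · simp
    have h1 : (m - L).choose (r + 1) = (m - (L + 1)).choose r + (m - (L + 1)).choose (r + 1) := by
      rw [show m - L = m - (L + 1) + 1 by omega, Nat.choose_succ_succ]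
    have h2 : (m - (L + 1)).choose r ≤ (m - 1).choose r := Nat.choose_le_choose r (by omega)
    have h3 : m * (m - 1).choose r = (r + 1) * m.choose (r + 1) := by
      have := Nat.add_one_mul_choose_eq (m - 1) r
      rw [show m - 1 + 1 = m by omega] at this
      rw [this, mul_comm]
    have h4 := Nat.mul_le_mul_left m h2
    rw [h3] at h4
    calc m * m.choose (r + 1)
        ≤ m * (m - L).choose (r + 1) + L * (r + 1) * m.choose (r + 1) := ih
      _ = m * (m - (L + 1)).choose r + m * (m - (L + 1)).choose (r + 1)
          + L * (r + 1) * m.choose (r + 1) := by rw [h1, mul_add]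
      _ ≤ _ := by
          have h5 : (L + 1) * (r + 1) * m.choose (r + 1)
            = (r + 1) * m.choose (r + 1) + L * (r + 1) * m.choose (r + 1) := by ring
          omega

variable {N K L : ℕ}

lemma Nbar_pos (hK : 0 < K) (hL : 0 < L) (hLN : L ≤ N) : 0 < Nbar N K L :=
  hL.trans_le (le_Nbar hK hLN)

lemma schemePoint_zero (hK : 0 < K) : schemePoint N K L 0 = (0, (Nbar N K L : ℝ)) := by
  have : ((K * Nbar N K L : ℕ) : ℝ) - ((K - 1) * Nbar N K L : ℕ) = Nbar N K L := by
    rw [Nat.sub_mul, one_mul, Nat.cast_sub (Nat.le_mul_of_pos_left _ hK)]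
    ring
  simp only [schemePoint, Nat.choose_zero_right, zero_add, Nat.choose_one_right, this]
  simp

lemma schemePoint_last (hK : 0 < K) (hL : 0 < L) (hLN : L ≤ N) :
    schemePoint N K L (K * Nbar N K L) = ((N : ℝ), 0) := by
  have hm : 0 < K * Nbar N K L := Nat.mul_pos hK (Nbar_pos hK hL hLN)
  have h1 : (K * Nbar N K L - L).choose (K * Nbar N K L) = 0 :=
    Nat.choose_eq_zero_of_lt (by omega)
  have h2 : ((K - 1) * Nbar N K L).choose (K * Nbar N K L + 1) = 0 :=
    Nat.choose_eq_zero_of_lt (Nat.lt_succ_of_le (Nat.mul_le_mul_right _ (Nat.sub_le K 1)))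
  simp [schemePoint, h1, h2]

lemma schemePoint_snd_nonneg (r : ℕ) : 0 ≤ (schemePoint N K L r).2 :=
  div_nonneg (sub_nonneg.2 (by
    exact_mod_cast Nat.choose_le_choose (r + 1) (Nat.mul_le_mul_right _ (Nat.sub_le K 1))))
    (Nat.cast_nonneg _)

lemma schemePoint_fst_le (hK : 0 < K) (hLN : L ≤ N) {r : ℕ}
    (hr : r ≤ K * Nbar N K L) :
    (schemePoint N K L r).1 * (K * Nbar N K L : ℕ) ≤ N * L * r := by
  have hLm : L ≤ K * Nbar N K L := (le_Nbar hK hLN).trans (Nat.le_mul_of_pos_left _ hK)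
  have hc : (0 : ℝ) < (K * Nbar N K L).choose r := by exact_mod_cast Nat.choose_pos hr
  have h := mul_choose_le_mul_choose_sub_add hLm r
  have h' : ((K * Nbar N K L : ℕ) : ℝ) * (K * Nbar N K L).choose r
      ≤ (K * Nbar N K L : ℕ) * (K * Nbar N K L - L).choose r
        + L * r * (K * Nbar N K L).choose r := by exact_mod_cast h
  simp only [schemePoint]
  rw [div_mul_eq_mul_div, div_mul_eq_mul_div, div_le_iff₀ hc]
  have := mul_le_mul_of_nonneg_left h' (Nat.cast_nonneg (α := ℝ) N)
  linarith

lemma schemePoint_snd_le {r : ℕ} (hr : r ≤ K * Nbar N K L) :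
    (schemePoint N K L r).2 * (r + 1) ≤ (K * Nbar N K L : ℕ) := by
  have hc : (0 : ℝ) < (K * Nbar N K L).choose r := by exact_mod_cast Nat.choose_pos hr
  have h1 : ((K * Nbar N K L).choose (r + 1) : ℝ) * (r + 1)
      ≤ (K * Nbar N K L : ℕ) * (K * Nbar N K L).choose r := by
    have := Nat.choose_succ_right_eq (K * Nbar N K L) r
    have h2 : (K * Nbar N K L).choose (r + 1) * (r + 1)
        ≤ (K * Nbar N K L) * (K * Nbar N K L).choose r := by
      rw [this, mul_comm]
      exact Nat.mul_le_mul_right _ (Nat.sub_le _ _)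
    exact_mod_cast h2
  simp only [schemePoint]
  rw [div_mul_eq_mul_div, div_le_iff₀ hc]
  refine le_trans (mul_le_mul_of_nonneg_right (sub_le_self _ (Nat.cast_nonneg _)) ?_) h1
  positivity

/-- The region of the proposed scheme: the convex hull of its memory-rate pairs. -/
def schemeRegion (N K L : ℕ) : Set (ℝ × ℝ) :=
  convexHull ℝ (schemePoint N K L '' Set.Icc 0 (K * Nbar N K L))

lemma schemePoint_mem {r : ℕ} (hr : r ≤ K * Nbar N K L) :
    schemePoint N K L r ∈ schemeRegion N K L :=
  subset_convexHull ℝ _ (Set.mem_image_of_mem _ ⟨Nat.zero_le _, hr⟩)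

lemma schemeRegion_snd_nonneg {p : ℝ × ℝ} (hp : p ∈ schemeRegion N K L) : 0 ≤ p.2 := by
  refine convexHull_min (t := {p : ℝ × ℝ | 0 ≤ p.2}) ?_ ?_ hp
  · rintro _ ⟨r, -, rfl⟩
    exact schemePoint_snd_nonneg r
  · exact convex_halfSpace_ge (LinearMap.snd ℝ ℝ ℝ).isLinear 0

lemma schemeRate_le {M R : ℝ} (h : (M, R) ∈ schemeRegion N K L) : schemeRate N K L M ≤ R :=
  csInf_le ⟨0, fun _ hR => schemeRegion_snd_nonneg hR⟩ h

/-- Interpolation between two points of the region. -/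
lemma schemeRegion_segment {p₁ p₂ : ℝ × ℝ} {M : ℝ} (h₁ : p₁ ∈ schemeRegion N K L)
    (h₂ : p₂ ∈ schemeRegion N K L) (hlt : p₁.1 < p₂.1) (hM : M ∈ Set.Icc p₁.1 p₂.1) :
    (M, ((p₂.1 - M) * p₁.2 + (M - p₁.1) * p₂.2) / (p₂.1 - p₁.1)) ∈ schemeRegion N K L := by
  have hd : 0 < p₂.1 - p₁.1 := sub_pos.2 hlt
  have h := convex_convexHull ℝ _ h₁ h₂ (a := (p₂.1 - M) / (p₂.1 - p₁.1))
    (b := (M - p₁.1) / (p₂.1 - p₁.1))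
    (div_nonneg (sub_nonneg.2 hM.2) hd.le) (div_nonneg (sub_nonneg.2 hM.1) hd.le)
    (by field_simp; ring)
  have he : (M, ((p₂.1 - M) * p₁.2 + (M - p₁.1) * p₂.2) / (p₂.1 - p₁.1))
      = ((p₂.1 - M) / (p₂.1 - p₁.1)) • p₁ + ((M - p₁.1) / (p₂.1 - p₁.1)) • p₂ := by
    refine Prod.ext ?_ ?_
    · simp only [Prod.fst_add, Prod.smul_fst, smul_eq_mul]
      field_simp
      ring
    · simp only [Prod.snd_add, Prod.smul_snd, smul_eq_mul]
      field_simp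
  rw [he]
  exact h

/-- The chord from `(0, N̄)` to `(N, 0)`. -/
lemma mem_schemeRegion_chord (hK : 0 < K) (hL : 0 < L) (hLN : L ≤ N) {M : ℝ}
    (hM : M ∈ Set.Icc (0 : ℝ) N) : (M, (N - M) * Nbar N K L / N) ∈ schemeRegion N K L := by
  have h₁ := schemePoint_mem (N := N) (K := K) (L := L) (Nat.zero_le _)
  have h₂ := schemePoint_mem (N := N) (K := K) (L := L) le_rfl
  rw [schemePoint_zero hK] at h₁
  rw [schemePoint_last hK hL hLN] at h₂
  have hN : (0 : ℝ) < N := by exact_mod_cast hL.trans_le hLN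
  simpa using schemeRegion_segment h₁ h₂ hN hM

/-- The envelope lies below the hyperbola `R = L N / M`. On the chord between the points for `r`
and `r + 1` the rate is at most `m / (r + 1)` with `m = K N̄`, and the memory at most
`N L (r + 1) / m`. -/
lemma exists_mem_schemeRegion_le (hK : 0 < K) (hL : 0 < L) (hLN : L ≤ N) {M : ℝ} (hM0 : 0 < M)
    (hMN : M ≤ N) : ∃ y, (M, y) ∈ schemeRegion N K L ∧ y ≤ L * N / M := by
  classical
  set m := K * Nbar N K L with hm
  have hmpos : 0 < m := Nat.mul_pos hK (Nbar_pos hK hL hLN)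
  have hm' : (0 : ℝ) < m := by exact_mod_cast hmpos
  have hlast := schemePoint_last (K := K) hK hL hLN
  set r := Nat.findGreatest (fun r => (schemePoint N K L r).1 ≤ M) m with hr
  have hr1 : (schemePoint N K L r).1 ≤ M := by
    refine Nat.findGreatest_spec (P := fun r => (schemePoint N K L r).1 ≤ M) (Nat.zero_le m) ?_
    rw [schemePoint_zero hK]
    exact hM0.le
  rcases (Nat.findGreatest_le (P := fun r => (schemePoint N K L r).1 ≤ M) m).eq_or_lt with h | h
  · rw [← hr] at h
    rw [h, hlast] at hr1
    obtain rfl : M = N := le_antisymm hMN hr1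
    refine ⟨0, ?_, by positivity⟩
    rw [← hlast]
    exact schemePoint_mem le_rfl
  · rw [← hr] at h
    have hr2 : M < (schemePoint N K L (r + 1)).1 :=
      not_le.1 (Nat.findGreatest_is_greatest (P := fun r => (schemePoint N K L r).1 ≤ M)
        (Nat.lt_succ_self r) h)
    refine ⟨_, schemeRegion_segment (schemePoint_mem h.le) (schemePoint_mem h)
      (hr1.trans_lt hr2) ⟨hr1, hr2.le⟩, ?_⟩
    have hbound : (m : ℝ) / (r + 1) ≤ L * N / M := by
      have h1 := schemePoint_fst_le (N := N) hK hLN h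
      push_cast at h1
      rw [div_le_div_iff₀ (by positivity) hM0]
      have h2 : M * m ≤ (schemePoint N K L (r + 1)).1 * m :=
        mul_le_mul_of_nonneg_right hr2.le hm'.le
      rw [hm] at h2 ⊢
      push_cast at h2 ⊢
      linarith
    have hs₁ : (schemePoint N K L r).2 ≤ m / (r + 1) := by
      rw [le_div_iff₀ (by positivity)]
      exact schemePoint_snd_le h.le
    have hs₂ : (schemePoint N K L (r + 1)).2 ≤ m / (r + 1) := by
      rw [le_div_iff₀ (by positivity)]
      have h1 := schemePoint_snd_le (N := N) (K := K) (L := L) h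
      have h2 := schemePoint_snd_nonneg (N := N) (K := K) (L := L) (r + 1)
      push_cast at h1 ⊢
      rw [hm]
      push_cast
      linarith
    refine le_trans ?_ hbound
    rw [div_le_iff₀ (sub_pos.2 (hr1.trans_lt hr2))]
    have e₁ := mul_le_mul_of_nonneg_left hs₁ (sub_nonneg.2 hr2.le)
    have e₂ := mul_le_mul_of_nonneg_left hs₂ (sub_nonneg.2 hr1)
    linarith

/-- The envelope is within a factor of `6` of any rate `R` that satisfies the averaged cut-set
bounds. -/
lemma schemeRate_le_six_mul (hK : 0 < K) (hL : 0 < L) (hLN : L ≤ N) {M R : ℝ}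
    (hM : M ∈ Set.Icc (0 : ℝ) N)
    (hR : ∀ i : ℕ, i ≤ K → i * L ≤ N → (i * L : ℝ) * (N - i * M) ≤ N * R) :
    schemeRate N K L M ≤ 6 * R := by
  have hN : (0 : ℝ) < N := by exact_mod_cast hL.trans_le hLN
  have hL' : (0 : ℝ) < L := by exact_mod_cast hL
  obtain ⟨hM0, hMN⟩ := hM
  have hchord := schemeRate_le (mem_schemeRegion_chord hK hL hLN ⟨hM0, hMN⟩)
  have hone := hR 1 hK (by simpa using hLN)
  have hR0 : 0 ≤ R := by
    have h1 : 0 ≤ N * R := le_trans (by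
      push_cast
      rw [one_mul, one_mul]
      exact mul_nonneg hL'.le (sub_nonneg.2 hMN)) hone
    exact nonneg_of_mul_nonneg_right h1 hN
  -- the largest number of users that can be served by disjoint demands
  set I := min K (N / L) with hI
  have hIK : I ≤ K := min_le_left _ _
  have hIN : I * L ≤ N := (Nat.mul_le_mul_right L (min_le_right _ _)).trans (Nat.div_mul_le_self N L)
  have hI1 : 1 ≤ I := le_min hK ((Nat.one_le_div_iff hL).2 hLN)
  have hNbar : Nbar N K L ≤ 2 * I * L := by
    rcases le_total K (N / L) with h | h
    · rw [hI, min_eq_left h]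
      refine (min_le_right _ _).trans ?_
      nlinarith [Nat.zero_le (K * L)]
    · rw [hI, min_eq_right h]
      refine (min_le_left _ _).trans ?_
      have h1 := Nat.lt_div_mul_add hL (a := N)
      have h2 : L ≤ N / L * L := Nat.le_mul_of_pos_left L ((Nat.one_le_div_iff hL).2 hLN)
      nlinarith
  have hNbar' : (Nbar N K L : ℝ) ≤ 2 * I * L := by exact_mod_cast hNbar
  have hIL := hR I hIK hIN
  by_cases hI2 : I = 1
  · rw [hI2] at hIL hNbar'
    refine hchord.trans ?_
    rw [div_le_iff₀ hN]
    have := mul_le_mul_of_nonneg_left hNbar' (sub_nonneg.2 hMN)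
    have h0 : 0 ≤ N * R := mul_nonneg hN.le hR0
    push_cast at *
    nlinarith
  have hI2' : 2 ≤ I := by omega
  by_cases h3 : (N : ℝ) ≤ 3 * M
  · -- the chord from the hyperbola at `N / 3` to `(N, 0)`
    obtain ⟨y, hy, hyle⟩ := exists_mem_schemeRegion_le (K := K) hK hL hLN (M := N / 3)
      (by positivity) (by linarith)
    have hy3 : y ≤ 3 * L := hyle.trans_eq (by field_simp)
    have h₂ := schemePoint_mem (N := N) (K := K) (L := L) le_rfl
    rw [schemePoint_last hK hL hLN] at h₂
    refine (schemeRate_le (schemeRegion_segment hy h₂ (by linarith)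
      ⟨by linarith, hMN⟩)).trans ?_
    rw [div_le_iff₀ (by linarith)]
    have h4 := mul_le_mul_of_nonneg_left hy3 (sub_nonneg.2 hMN)
    have h0 : 0 ≤ N * R := mul_nonneg hN.le hR0
    push_cast at hone
    linarith
  push Not at h3
  by_cases hsmall : (2 * I + 1 : ℝ) * M ≤ N
  · -- all users can be served with disjoint demands
    have hU : schemeRate N K L M ≤ 2 * I * L := by
      refine hchord.trans (le_trans ?_ hNbar')
      rw [div_le_iff₀ hN]
      have : (0 : ℝ) ≤ M * Nbar N K L := by positivity
      linarith
    have hIp : (0 : ℝ) < I * L := by positivity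
    have h5 : (N : ℝ) / 2 ≤ N - I * M := by linarith
    have h6 := (mul_le_mul_of_nonneg_left h5 hIp.le).trans hIL
    have h7 : (I * L : ℝ) ≤ 2 * R := by
      refine le_of_mul_le_mul_left ?_ hN
      linarith
    linarith
  push Not at hsmall
  have hMpos : 0 < M := by
    rcases hM0.eq_or_lt with h | h
    · rw [← h, mul_zero] at hsmall
      exact absurd hsmall (not_lt.2 hN.le)
    · exact h
  -- the optimal number of users is about `N / (2 M)`
  set i := ⌊((N : ℝ) / M + 1) / 2⌋₊ with hi
  have hi1 : (2 * i - 1 : ℝ) * M ≤ N := by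
    have h4 : (i : ℝ) ≤ ((N : ℝ) / M + 1) / 2 := Nat.floor_le (by positivity)
    rw [← le_div_iff₀ hMpos]
    linarith
  have hi2 : (N : ℝ) < (2 * i + 1) * M := by
    have h4 : ((N : ℝ) / M + 1) / 2 < i + 1 := Nat.lt_floor_add_one _
    rw [← div_lt_iff₀ hMpos]
    linarith
  have hiI : i ≤ I := by
    by_contra hlt
    have : (I : ℝ) + 1 ≤ i := by exact_mod_cast not_le.1 hlt
    have : (2 * I + 1 : ℝ) * M ≤ (2 * i - 1) * M :=
      mul_le_mul_of_nonneg_right (by linarith) hMpos.le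
    linarith
  have hi2' : 2 ≤ i := by
    by_contra hlt
    have : (i : ℝ) ≤ 1 := by exact_mod_cast Nat.lt_succ_iff.1 (not_le.1 hlt)
    have : (2 * i + 1 : ℝ) * M ≤ 3 * M := mul_le_mul_of_nonneg_right (by linarith) hMpos.le
    linarith
  have hir : (2 : ℝ) ≤ i := by exact_mod_cast hi2'
  have hcut := hR i (hiI.trans hIK) ((Nat.mul_le_mul_right L hiI).trans hIN)
  obtain ⟨y, hy, hyle⟩ := exists_mem_schemeRegion_le (K := K) hK hL hLN hMpos hMN
  refine (schemeRate_le hy).trans (hyle.trans ?_)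
  rw [div_le_iff₀ hMpos]
  -- `x = i M` lies between `N / 3` and `2 N / 3`, so that `x (N - x) ≥ 2 N ^ 2 / 9`
  have hx1 : (N : ℝ) ≤ 3 * (i * M) := by nlinarith
  have hx2 : 3 * (i * M) ≤ 2 * (N : ℝ) := by nlinarith
  have hx : (2 : ℝ) * N ^ 2 ≤ 9 * ((i * M) * (N - i * M)) := by nlinarith
  have h8 := mul_le_mul_of_nonneg_left hcut hMpos.le
  refine le_of_mul_le_mul_left ?_ hN
  have h9 := mul_le_mul_of_nonneg_left hx hL'.le
  have h10 : 0 ≤ (L : ℝ) * N ^ 2 := by positivity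
  nlinarith

end Envelope

end CodedCaching

end

theorem theorem3 (q N K L : ℕ) [Fact q.Prime] (hK : 0 < K) (hL : 0 < L) (hLN : L ≤ N)
    (δ : Fin K → CodedCaching.Demand N L → ℝ)
    (hδ : ∀ k, δ k ∈ stdSimplex ℝ (CodedCaching.Demand N L))
    (hδpos : ∀ k d, 0 < δ k d)
    (M : ℝ) (hM : M ∈ Set.Icc (0 : ℝ) N) :
    CodedCaching.Achievable q N K L δ M (CodedCaching.schemeRate N K L M) ∧
      CodedCaching.optimalRate q N K L δ M ≤ CodedCaching.schemeRate N K L M ∧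
      CodedCaching.schemeRate N K L M ≤ 6 * CodedCaching.optimalRate q N K L δ M := by
  have hN : 0 < N := hL.trans_le hLN
  have hcut : ∀ R, CodedCaching.Achievable q N K L δ M R →
      CodedCaching.schemeRate N K L M ≤ 6 * R := fun R hR =>
    CodedCaching.schemeRate_le_six_mul hK hL hLN hM fun i hiK hiN =>
      hR.cutSet hδ hδpos hN hLN hiK hiN
  have hne : {R : ℝ | (M, R) ∈ CodedCaching.schemeRegion N K L}.Nonempty :=
    ⟨_, CodedCaching.mem_schemeRegion_chord hK hL hLN hM⟩
  have hclosed : IsClosed {R : ℝ | (M, R) ∈ CodedCaching.schemeRegion N K L} :=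
    (((Set.finite_Icc _ _).image _).isClosed_convexHull ℝ).preimage (by fun_prop)
  have hach : CodedCaching.Achievable q N K L δ M (CodedCaching.schemeRate N K L M) :=
    CodedCaching.achievable_of_mem_convexHull hK hLN δ hδ
      (hclosed.csInf_mem hne ⟨0, fun _ hR => CodedCaching.schemeRegion_snd_nonneg hR⟩)
  refine ⟨hach, csInf_le ⟨CodedCaching.schemeRate N K L M / 6, fun R hR => ?_⟩ hach, ?_⟩
  · have := hcut R hR
    linarith
  · have : CodedCaching.schemeRate N K L M / 6 ≤ CodedCaching.optimalRate q N K L δ M :=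
      le_csInf ⟨_, hach⟩ fun R hR => by
        have := hcut R hR
        linarith
    linarith
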